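/- Let $H$ be a separable real Hilbert space and $A$ a selfadjoint, strictly positive linear operator on $H$ with dense domain $\mathcal D(A)$ and compact inverse. Let $V=\mathcal D(A^{1/2})$ with $\langle u_1,u_2\rangle_V=\langle A^{1/2}u_1,A^{1/2}u_2\rangle_H$. Let $\ell\in(0,\infty]$, $\Omega=(0,\ell)$, and let $\mu:\Omega\to(0,\infty)$ be nonincreasing, summable and absolutely continuous on every compact interval contained in $\Omega$, with $\mu(s)\to0$ as $s\to\ell$ (automatic if $\ell=\infty$). Put $\nu=1/\mu$ and $\nu(0)=\lim_{\tau\to0}\nu(\tau)$, and let $\mathcal V=L^2_\nu(\Omega;V)$ be the space of (classes of) measurable $\xi:\Omega\to V$ with $\|\xi\|_{\mathcal V}^2=\int_0^\ell\nu(\tau)\|\xi(\tau)\|_V^2\,d\tau<\infty$. Let $P\xi=D\xi$ (distributional derivative on $\Omega$) with domain $$\mathcal D(P)=\{\xi\in\mathcal V: D\xi\in\mathcal V,\ \lim_{\tau\to\ell}\xi(\tau)=0\text{ in }V\}.$$ On $\mathfrak A=V\times H\times\mathcal V$, with $\|(u,v,\xi)\|_{\mathfrak A}^2=\|u\|_V^2+\|v\|_H^2+\|\xi\|_{\mathcal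 V}^2$, let $$\mathbb A(u,v,\xi)=\Big(v,\,-A\Big[u+\int_0^\ell\xi(\tau)\,d\tau\Big],\,P\xi+\mu v\Big),$$ $$\mathcal D(\mathbb A)=\Big\{(u,v,\xi)\in\mathfrak A: v\in V,\ u+\int_0^\ell\xi(\tau)\,d\tau\in\mathcal D(A),\ \xi\in\mathcal D(P)\Big\}.$$ **Theorem.** The operator $\mathbb A$ is the infinitesimal generator of a strongly continuous semigroup of contractions $S(t)=e^{t\mathbb A}$ on $\mathfrak A$, and of only one. For every $z\in\mathfrak A$, the function $Z(t)=S(t)z$ is the unique mild solution of $\frac{d}{dt}Z=\mathbb AZ$, $Z(0)=z$, that is, the unique $Z\in C([0,\infty),\mathfrak A)$ such that $\int_0^tZ(s)\,ds\in\mathcal D(\mathbb A)$ and $Z(t)=z+\mathbb A\int_0^tZ(s)\,ds$ for all $t\ge0$. Moreover, let $z\in\mathcal D(\mathbb A)$. Then, for all $t\ge0$, $S(t)z\in\mathcal D(\mathbb A)$ and, writing $\xi^t$ for the continuous representative of the third component of $S(t)z$, the limit $\nu(0)\|\xi^t(0)\|_V^2:=\lim_{\tau\to0}\nu(\tau)\|\xi^t(\tau)\|_V^2$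 exists and is finite (it is $0$ if $\nu(0)=0$, and if $\nu(0)>0$ then $\xi^t(\tau)$ has a limit $\xi^t(0)$ in $V$ as $\tau\to0$ and the value is $\nu(0)$ times $\|\xi^t(0)\|_V^2$), the function $\nu'\|\xi^t\|_V^2$ is summable on $\Omega$, and $$\frac{d}{dt}\|S(t)z\|_{\mathfrak A}^2=-\nu(0)\|\xi^t(0)\|_V^2-\int_0^\ell\nu'(\tau)\|\xi^t(\tau)\|_V^2\,d\tau$$ (the derivative at $t=0$ being one-sided). -/

import Mathlib

open MeasureTheory Filter Set
open scoped Topology NNReal ENNReal InnerProductSpace ContDiff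

namespace StateMemory

/-- `A` is a densely defined (possibly unbounded) selfadjoint strictly positive operator on the real
Hilbert space `H`, and it has a compact inverse `K = A⁻¹`, defined on all of `H`. -/
structure IsStrictlyPositiveOp {H : Type*} [NormedAddCommGroup H] [InnerProductSpace ℝ H]
    [CompleteSpace H] (A : H →ₗ.[ℝ] H) : Prop where
  dense : Dense (A.domain : Set H)
  selfAdjoint : IsSelfAdjoint A
  pos : ∀ x : A.domain, x ≠ 0 → 0 < ⟪A x, (x : H)⟫_ℝ
  compactInverse : ∃ K : H →L[ℝ] H, IsCompactOperator K ∧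
    (∀ x : A.domain, K (A x) = x) ∧ ∀ y : H, ∃ h : K y ∈ A.domain, A ⟨K y, h⟩ = y

/-- `B = A^(1/2)`: `B` is the positive selfadjoint operator with `B² = A`. In `sq` the domain of `B²` is
`{x ∈ D(B) | B x ∈ D(B)}`, and both the domains and the values of `A` and `B²` are required to agree. -/
structure IsPositiveSqrt {H : Type*} [NormedAddCommGroup H] [InnerProductSpace ℝ H]
    [CompleteSpace H] (B A : H →ₗ.[ℝ] H) : Prop where
  dense : Dense (B.domain : Set H)
  selfAdjoint : IsSelfAdjoint B
  nonneg : ∀ x : B.domain, 0 ≤ ⟪B x, (x : H)⟫_ℝ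
  sq : ∀ x y : H, (∃ h : x ∈ A.domain, A ⟨x, h⟩ = y) ↔
    ∃ (h : x ∈ B.domain) (h' : B ⟨x, h⟩ ∈ B.domain), B ⟨B ⟨x, h⟩, h'⟩ = y

section Sqrt

variable {H : Type*} [NormedAddCommGroup H] [InnerProductSpace ℝ H] [CompleteSpace H]

/-- A positive symmetric compact operator has a positive symmetric square root. -/
theorem exists_sqrt_of_compact (K : H →L[ℝ] H) (hK : IsCompactOperator K)
    (hs : ∀ x y, ⟪K x, y⟫_ℝ = ⟪x, K y⟫_ℝ) (hp : ∀ x, 0 ≤ ⟪K x, x⟫_ℝ) :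
    ∃ S : H →L[ℝ] H, (∀ x y, ⟪S x, y⟫_ℝ = ⟪x, S y⟫_ℝ) ∧ (∀ x, 0 ≤ ⟪S x, x⟫_ℝ) ∧
      ∀ x, S (S x) = K x := by
  classical
  have hs' : (K : H →ₗ[ℝ] H).IsSymmetric := hs
  let F : ℝ → Submodule ℝ H := fun μ => Module.End.eigenspace (K : Module.End ℝ H) μ
  have hFmem : ∀ (μ : ℝ) (x : H), x ∈ F μ → K x = μ • x := fun μ x hx =>
    Module.End.mem_eigenspace_iff.1 hx
  have hclosed : ∀ μ, IsClosed (F μ : Set H) := by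
    intro μ
    have : (F μ : Set H) = {x | K x = μ • x} := by
      ext x; exact Module.End.mem_eigenspace_iff
    rw [this]
    exact isClosed_eq K.continuous (continuous_const_smul μ)
  have : ∀ μ, CompleteSpace (F μ) := fun μ => (hclosed μ).completeSpace_coe
  have hV : IsHilbertSum ℝ (fun μ => F μ) fun μ => (F μ).subtypeₗᵢ := by
    refine IsHilbertSum.mkInternal F hs'.orthogonalFamily_eigenspaces ?_
    have := K.orthogonalComplement_iSup_eigenspaces_eq_bot hK hs'
    rw [Submodule.topologicalClosure_eq_top_iff.2 this]
  let U := hV.linearIsometryEquiv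
  have hev : ∀ (μ : ℝ) (x : F μ), x ≠ 0 → 0 ≤ μ ∧ μ ≤ ‖K‖ := by
    intro μ x hx
    have hx' : 0 < ‖(x : H)‖ := by simpa using hx
    have h1 := hFmem μ x x.2
    have h2 := hp x
    rw [h1, inner_smul_left, real_inner_self_eq_norm_sq] at h2
    have h3 := K.le_opNorm x
    rw [h1, norm_smul] at h3
    refine ⟨?_, ?_⟩
    · by_contra! h
      have : μ * ‖(x : H)‖ ^ 2 < 0 := mul_neg_of_neg_of_pos h (by positivity)
      simp at h2
      linarith
    · exact (le_abs_self μ).trans (le_of_mul_le_mul_right h3 hx')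
  have hmem : ∀ f : lp (fun μ => F μ) 2, Memℓp (fun μ => Real.sqrt μ • f μ) 2 := by
    intro f
    have hf := (lp.memℓp f).summable (by norm_num)
    refine memℓp_gen ?_
    refine Summable.of_nonneg_of_le (fun μ => by positivity) (fun μ => ?_)
      (hf.mul_left ‖K‖)
    by_cases hx : f μ = 0
    · simp [hx]
    · obtain ⟨h0, h1⟩ := hev μ _ hx
      have : ‖√μ • f μ‖ ^ 2 = μ * ‖f μ‖ ^ 2 := by
        rw [norm_smul, mul_pow, Real.norm_eq_abs, sq_abs, Real.sq_sqrt h0]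
      simp only [ENNReal.toReal_ofNat, Real.rpow_ofNat]
      rw [this]
      gcongr
  let D : lp (fun μ => F μ) 2 →ₗ[ℝ] lp (fun μ => F μ) 2 :=
    { toFun := fun f => ⟨fun μ => Real.sqrt μ • f μ, hmem f⟩
      map_add' := fun f g => by
        ext μ
        exact smul_add (Real.sqrt μ) (f μ : H) (g μ : H)
      map_smul' := fun c f => by
        ext μ
        exact smul_comm (Real.sqrt μ) c (f μ : H) }
  have hDapp : ∀ f μ, (D f) μ = Real.sqrt μ • f μ := fun f μ => rfl
  let S₀ : H →ₗ[ℝ] H := U.symm.toLinearEquiv.toLinearMap ∘ₗ D ∘ₗ U.toLinearEquiv.toLinearMap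
  have hS₀ : ∀ x, U (S₀ x) = D (U x) := fun x => by simp [S₀]
  have hinner : ∀ x y, ⟪S₀ x, y⟫_ℝ = ∑' μ, Real.sqrt μ * ⟪(U x) μ, (U y) μ⟫_ℝ := by
    intro x y
    rw [← U.inner_map_map, hS₀, lp.inner_eq_tsum]
    simp [hDapp, inner_smul_left]
  have hsym : S₀.IsSymmetric := by
    intro x y
    rw [hinner, real_inner_comm, hinner]
    simp [real_inner_comm]
  have hKU : ∀ (f : lp (fun μ => F μ) 2) , HasSum (fun μ => μ • (f μ : H)) (K (U.symm f)) := by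
    intro f
    have := (hV.hasSum_linearIsometryEquiv_symm f).mapL K
    convert this using 2 with μ
    exact (hFmem μ _ (f μ).2).symm
  refine ⟨⟨S₀, hsym.continuous⟩, hsym, ?_, ?_⟩
  · intro x
    change 0 ≤ ⟪S₀ x, x⟫_ℝ
    rw [hinner]
    refine tsum_nonneg fun μ => mul_nonneg (Real.sqrt_nonneg _) real_inner_self_nonneg
  · intro x
    change S₀ (S₀ x) = K x
    have h1 := hKU (U x)
    rw [U.symm_apply_apply] at h1
    have h2 : S₀ (S₀ x) = U.symm (D (D (U x))) := by simp [S₀]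
    rw [h2]
    refine (hV.hasSum_linearIsometryEquiv_symm (D (D (U x)))).unique ?_
    convert h1 using 2 with μ
    by_cases hx : (U x) μ = 0
    · simp [hDapp, hx]
    · obtain ⟨h0, -⟩ := hev μ _ hx
      simp [hDapp, smul_smul, Real.mul_self_sqrt h0]

/-- Existence of the positive selfadjoint square root. -/
theorem exists_positiveSqrt {A : H →ₗ.[ℝ] H} (hA : IsStrictlyPositiveOp A) :
    ∃ B : H →ₗ.[ℝ] H, IsPositiveSqrt B A := by
  obtain ⟨K, hKc, hKA, hAK⟩ := hA.compactInverse
  have hfa : ∀ x y : A.domain, ⟪A x, (y : H)⟫_ℝ = ⟪(x : H), A y⟫_ℝ := by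
    intro x y
    have h := LinearPMap.adjoint_isFormalAdjoint (T := A) hA.dense
    have hs : A.adjoint = A := hA.selfAdjoint
    rw [hs] at h
    exact h x y
  have hs : ∀ x y, ⟪K x, y⟫_ℝ = ⟪x, K y⟫_ℝ := by
    intro x y
    obtain ⟨hx, hx'⟩ := hAK x
    obtain ⟨hy, hy'⟩ := hAK y
    have := hfa ⟨K x, hx⟩ ⟨K y, hy⟩
    rw [hx', hy'] at this
    exact this.symm
  have hp : ∀ x, 0 ≤ ⟪K x, x⟫_ℝ := by
    intro x
    obtain ⟨hx, hx'⟩ := hAK x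
    by_cases h : (⟨K x, hx⟩ : A.domain) = 0
    · have : K x = 0 := congrArg Subtype.val h
      simp [this]
    · have := hA.pos _ h
      rw [hx', real_inner_comm] at this
      exact this.le
  obtain ⟨S, hSs, hSp, hSS⟩ := exists_sqrt_of_compact K hKc hs hp
  have hSinj : ∀ x, S x = 0 → x = 0 := by
    intro x hx
    obtain ⟨h, h'⟩ := hAK x
    have hK0 : K x = 0 := by rw [← hSS, hx, map_zero]
    have : (⟨K x, h⟩ : A.domain) = 0 := Subtype.ext hK0
    rw [← h', this, LinearPMap.map_zero]
  let S' : H →ₗ.[ℝ] H := ⟨⊤, (S : H →ₗ[ℝ] H) ∘ₗ (⊤ : Submodule ℝ H).subtype⟩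
  have hker : S'.toFun.ker = ⊥ := by
    rw [LinearMap.ker_eq_bot']
    intro m hm
    exact Subtype.ext (hSinj _ hm)
  let B := S'.inverse
  have hBdom : ∀ x, x ∈ B.domain ↔ ∃ h, S h = x := by
    intro x
    rw [LinearPMap.inverse_domain]
    constructor
    · rintro ⟨h, rfl⟩; exact ⟨h, rfl⟩
    · rintro ⟨h, rfl⟩; exact ⟨⟨h, trivial⟩, rfl⟩
  have hBS : ∀ (h : H) (hm : S h ∈ B.domain), B ⟨S h, hm⟩ = h := by
    intro h hm
    exact LinearPMap.inverse_apply_eq hker (y := ⟨S h, hm⟩) (x := ⟨h, trivial⟩) rfl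
  have hSmem : ∀ h, S h ∈ B.domain := fun h => (hBdom _).2 ⟨h, rfl⟩
  have hBd : Dense (B.domain : Set H) := by
    rw [Submodule.dense_iff_topologicalClosure_eq_top, Submodule.topologicalClosure_eq_top_iff,
      Submodule.eq_bot_iff]
    intro y hy
    apply hSinj
    rw [← inner_self_eq_zero (𝕜 := ℝ), hSs, real_inner_comm]
    exact Submodule.inner_right_of_mem_orthogonal (hSmem (S y)) hy |> fun h => by
      simpa using h
  have hBform : ∀ x y : B.domain, ⟪B x, (y : H)⟫_ℝ = ⟪(x : H), B y⟫_ℝ := by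
    rintro ⟨x, hx⟩ ⟨y, hy⟩
    obtain ⟨h, rfl⟩ := (hBdom x).1 hx
    obtain ⟨k, rfl⟩ := (hBdom y).1 hy
    rw [hBS, hBS]
    exact (hSs h k).symm
  refine ⟨B, hBd, ?_, ?_, ?_⟩
  · change B.adjoint = B
    refine le_antisymm ?_ (LinearPMap.IsFormalAdjoint.le_adjoint hBd hBform)
    have hmem : ∀ y ∈ B.adjoint.domain, ∀ hy : y ∈ B.adjoint.domain,
        y = S (B.adjoint ⟨y, hy⟩) := by
      intro y _ hy
      refine ext_inner_right ℝ fun h => ?_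
      have := LinearPMap.adjoint_isFormalAdjoint (T := B) hBd ⟨y, hy⟩ ⟨S h, hSmem h⟩
      rw [hBS] at this
      rw [hSs]
      exact this.symm
    refine ⟨fun y hy => (hBdom y).2 ⟨_, (hmem y hy hy).symm⟩, ?_⟩
    rintro ⟨y, hy⟩ ⟨z, hz⟩ (rfl : y = z)
    have h := hmem y hy hy
    have hgen : ∀ (w : H) (hw : w ∈ B.domain) (k : H), w = S k → B ⟨w, hw⟩ = k := by
      rintro w hw k rfl
      exact hBS k hw
    exact (hgen y hz _ h).symm
  · rintro ⟨x, hx⟩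
    obtain ⟨h, rfl⟩ := (hBdom x).1 hx
    rw [hBS, real_inner_comm]
    exact hSp h
  · intro x y
    constructor
    · rintro ⟨h, rfl⟩
      have hx : x = S (S (A ⟨x, h⟩)) := by rw [hSS, hKA]
      have hxd : x ∈ B.domain := by rw [hx]; exact hSmem _
      have hgen : ∀ (w : H) (hw : w ∈ B.domain) (k : H), w = S k → B ⟨w, hw⟩ = k := by
        rintro w hw k rfl
        exact hBS k hw
      have h1 := hgen x hxd _ hx
      exact ⟨hxd, h1 ▸ hSmem _, hgen _ _ _ h1⟩
    · rintro ⟨hx, hx', rfl⟩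
      obtain ⟨h, rfl⟩ := (hBdom x).1 hx
      have e := hBS h hx
      obtain ⟨k, rfl⟩ := (hBdom h).1 (e ▸ hx')
      have hgen : ∀ (w : H) (hw : w ∈ B.domain) (k : H), w = S k → B ⟨w, hw⟩ = k := by
        rintro w hw k rfl
        exact hBS k hw
      rw [hgen _ hx' _ e]
      obtain ⟨hk, hk'⟩ := hAK k
      have : ∀ (w : H) (_ : w = K k), ∃ h : w ∈ A.domain, A ⟨w, h⟩ = k := by
        rintro w rfl
        exact ⟨hk, hk'⟩
      exact this _ (hSS k)

end Sqrt

section EnergySpace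

variable {H : Type*} [NormedAddCommGroup H] [InnerProductSpace ℝ H] [CompleteSpace H]
  {A : H →ₗ.[ℝ] H}

/-- The operator `A^(1/2)`, the positive selfadjoint square root of `A`. -/
noncomputable def sqrtOp (hA : IsStrictlyPositiveOp A) : H →ₗ.[ℝ] H :=
  Classical.choose (exists_positiveSqrt hA)

theorem sqrtOp_spec (hA : IsStrictlyPositiveOp A) : IsPositiveSqrt (sqrtOp hA) A :=
  Classical.choose_spec (exists_positiveSqrt hA)

/-- The Hilbert space `V = D(A^(1/2))`, with `⟪u, v⟫_V = ⟪A^(1/2) u, A^(1/2) v⟫_H`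
and `‖u‖_V = ‖A^(1/2) u‖_H`. -/
def EnergySpace (hA : IsStrictlyPositiveOp A) : Type _ := (sqrtOp hA).domain

namespace EnergySpace

variable (hA : IsStrictlyPositiveOp A)

noncomputable instance : AddCommGroup (EnergySpace hA) := inferInstanceAs (AddCommGroup (sqrtOp hA).domain)

noncomputable instance : Module ℝ (EnergySpace hA) := inferInstanceAs (Module ℝ (sqrtOp hA).domain)

/-- The inclusion of `V` in `H`. -/
noncomputable def incl : EnergySpace hA →ₗ[ℝ] H := (sqrtOp hA).domain.subtype

/-- An element of `D(A^(1/2))`, as an element of `V`. -/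
def mk (x : H) (hx : x ∈ (sqrtOp hA).domain) : EnergySpace hA :=
  (⟨x, hx⟩ : (sqrtOp hA).domain)

/-- The operator `A^(1/2)` as a map from `V` to `H`. -/
noncomputable def root : EnergySpace hA →ₗ[ℝ] H := (sqrtOp hA).toFun

theorem sqrtOp_formal (x y : (sqrtOp hA).domain) :
    ⟪sqrtOp hA x, (y : H)⟫_ℝ = ⟪(x : H), sqrtOp hA y⟫_ℝ := by
  have h := LinearPMap.adjoint_isFormalAdjoint (T := sqrtOp hA) (sqrtOp_spec hA).dense
  have hs : (sqrtOp hA).adjoint = sqrtOp hA := (sqrtOp_spec hA).selfAdjoint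
  rw [hs] at h
  exact h x y

theorem root_injective : Function.Injective (root hA) := by
  rw [injective_iff_map_eq_zero]
  intro u hu
  have hu' : sqrtOp hA ⟨(u : (sqrtOp hA).domain).1, (u : (sqrtOp hA).domain).2⟩ = 0 := hu
  have hm : sqrtOp hA ⟨(u : (sqrtOp hA).domain).1, (u : (sqrtOp hA).domain).2⟩ ∈
      (sqrtOp hA).domain := by
    rw [hu']; exact Submodule.zero_mem _
  obtain ⟨h, h'⟩ := ((sqrtOp_spec hA).sq (u : (sqrtOp hA).domain).1 0).2
    ⟨(u : (sqrtOp hA).domain).2, hm, by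
      have : (⟨_, hm⟩ : (sqrtOp hA).domain) = 0 := Subtype.ext hu'
      rw [this, LinearPMap.map_zero]⟩
  by_contra hne
  have hne' : (⟨(u : (sqrtOp hA).domain).1, h⟩ : A.domain) ≠ 0 := by
    intro h0
    have h1 := congrArg Subtype.val h0
    exact hne (Subtype.ext h1)
  have := hA.pos _ hne'
  rw [h', inner_zero_left] at this
  exact lt_irrefl _ this

theorem root_surjective : Function.Surjective (root hA) := by
  intro y
  obtain ⟨K, -, -, hAK⟩ := hA.compactInverse
  obtain ⟨h, h'⟩ := hAK y
  obtain ⟨h1, h2, h3⟩ := ((sqrtOp_spec hA).sq (K y) y).1 ⟨h, h'⟩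
  exact ⟨⟨_, h2⟩, h3⟩

@[reducible] noncomputable def core : InnerProductSpace.Core ℝ (EnergySpace hA) where
  inner u v := ⟪root hA u, root hA v⟫_ℝ
  conj_inner_symm u v := by simp [real_inner_comm]
  re_inner_nonneg u := by simp
  add_left u v w := by simp [inner_add_left]
  smul_left u v r := by simp [inner_smul_left]
  definite u hu := (injective_iff_map_eq_zero (root hA)).1 (root_injective hA) u
    (inner_self_eq_zero.1 hu)

noncomputable instance : NormedAddCommGroup (EnergySpace hA) :=
  (core hA).toNormedAddCommGroup

noncomputable instance : InnerProductSpace ℝ (EnergySpace hA) :=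
  InnerProductSpace.ofCore (core hA).toCore

theorem inner_eq (u v : EnergySpace hA) : ⟪u, v⟫_ℝ = ⟪root hA u, root hA v⟫_ℝ := rfl

theorem norm_eq (u : EnergySpace hA) : ‖u‖ = ‖root hA u‖ := by
  rw [norm_eq_sqrt_real_inner, norm_eq_sqrt_real_inner, inner_eq]

/-- `A^(1/2)` is an isometry of `V` onto `H`; hence `V` is complete. -/
noncomputable def rootEquiv : EnergySpace hA ≃ₗᵢ[ℝ] H where
  toLinearEquiv := LinearEquiv.ofBijective (root hA) ⟨root_injective hA, root_surjective hA⟩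
  norm_map' u := (norm_eq hA u).symm

instance : CompleteSpace (EnergySpace hA) :=
  (rootEquiv hA).toIsometryEquiv.completeSpace

end EnergySpace

end EnergySpace


section Kernel

/-- The interval `Ω = (0, ℓ)`, where `ℓ ∈ (0, ∞]`. -/
def memInterval (ℓ : EReal) : Set ℝ := {s | 0 < s ∧ (s : EReal) < ℓ}

/-- The filter `s → ℓ`, `s < ℓ`, on the real line (this is `s → ∞` if `ℓ = ∞`). -/
noncomputable def rightEnd (ℓ : EReal) : Filter ℝ := comap (fun s : ℝ => (s : EReal)) (𝓝[<] ℓ)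

/-- `μ : Ω → (0, ∞)` is nonincreasing, summable, absolutely continuous on every compact interval
contained in `Ω`, and `μ(s) → 0` as `s → ℓ` (which is automatic if `ℓ = ∞`). Only the values of
`μ` on `Ω` matter. -/
structure IsMemoryKernel (ℓ : EReal) (μ : ℝ → ℝ) : Prop where
  pos : ∀ s ∈ memInterval ℓ, 0 < μ s
  antitone : AntitoneOn μ (memInterval ℓ)
  integrable : IntegrableOn μ (memInterval ℓ)
  absCont : ∀ a ∈ memInterval ℓ, ∀ b ∈ memInterval ℓ, a ≤ b → AbsolutelyContinuousOnInterval μ a b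
  tendsto_zero : Tendsto μ (rightEnd ℓ) (𝓝 0)

/-- The kernel `ν = 1 / μ`. -/
noncomputable def nu (μ : ℝ → ℝ) (τ : ℝ) : ℝ := 1 / μ τ

/-- The measure `ν(τ) dτ` on `Ω`. -/
noncomputable def stateMeasure (ℓ : EReal) (μ : ℝ → ℝ) : Measure ℝ :=
  (volume.restrict (memInterval ℓ)).withDensity fun τ => ENNReal.ofReal (nu μ τ)

/-- The weighted space `L²_ν(Ω; X)`, with `‖ξ‖² = ∫_Ω ν(τ) ‖ξ(τ)‖² dτ`. -/
abbrev StateSpace (ℓ : EReal) (μ : ℝ → ℝ) (X : Type*) [NormedAddCommGroup X] : Type _ :=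
  Lp X 2 (stateMeasure ℓ μ)

theorem isOpen_memInterval (ℓ : EReal) : IsOpen (memInterval ℓ) :=
  (isOpen_lt continuous_const continuous_id).inter
    (isOpen_lt continuous_coe_real_ereal continuous_const)

theorem measurableSet_memInterval (ℓ : EReal) : MeasurableSet (memInterval ℓ) :=
  (isOpen_memInterval ℓ).measurableSet

theorem stateMeasure_ac (ℓ : EReal) (μ : ℝ → ℝ) : stateMeasure ℓ μ ≪ volume.restrict (memInterval ℓ) :=
  withDensity_absolutelyContinuous _ _

namespace IsMemoryKernel

variable {ℓ : EReal} {μ : ℝ → ℝ}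

theorem aemeasurable (hμ : IsMemoryKernel ℓ μ) : AEMeasurable μ (volume.restrict (memInterval ℓ)) :=
  aemeasurable_restrict_of_antitoneOn (measurableSet_memInterval ℓ) hμ.antitone

theorem aemeasurable_density (hμ : IsMemoryKernel ℓ μ) :
    AEMeasurable (fun τ => ENNReal.ofReal (nu μ τ)) (volume.restrict (memInterval ℓ)) :=
  (hμ.aemeasurable.const_div 1).ennreal_ofReal

theorem ac_stateMeasure (hμ : IsMemoryKernel ℓ μ) : volume.restrict (memInterval ℓ) ≪ stateMeasure ℓ μ := by
  refine withDensity_absolutelyContinuous' hμ.aemeasurable_density ?_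
  filter_upwards [ae_restrict_mem (measurableSet_memInterval ℓ)] with τ hτ
  have := hμ.pos τ hτ
  simp [nu, this]

theorem memLp_iff (hμ : IsMemoryKernel ℓ μ) {X : Type*} [NormedAddCommGroup X] {f : ℝ → X}
    (hf : AEStronglyMeasurable f (volume.restrict (memInterval ℓ))) :
    MemLp f 2 (stateMeasure ℓ μ) ↔ IntegrableOn (fun τ => nu μ τ * ‖f τ‖ ^ 2) (memInterval ℓ) := by
  rw [memLp_two_iff_integrable_sq_norm (hf.mono_ac (stateMeasure_ac ℓ μ)), stateMeasure,
    integrable_withDensity_iff_integrable_smul₀' hμ.aemeasurable_density (by simp)]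
  refine integrable_congr ?_
  filter_upwards [ae_restrict_mem (measurableSet_memInterval ℓ)] with τ hτ
  have : 0 ≤ nu μ τ := one_div_nonneg.2 (hμ.pos τ hτ).le
  simp [ENNReal.toReal_ofReal this]

variable {X : Type*} [NormedAddCommGroup X]

theorem integrable_coe (hμ : IsMemoryKernel ℓ μ) (ξ : StateSpace ℓ μ X) : IntegrableOn ξ (memInterval ℓ) := by
  have hm : AEStronglyMeasurable ξ (volume.restrict (memInterval ℓ)) :=
    (Lp.aestronglyMeasurable ξ).mono_ac hμ.ac_stateMeasure
  have h := (hμ.memLp_iff hm).1 (Lp.memLp ξ)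
  refine (hμ.integrable.add h).mono' hm ?_
  filter_upwards [ae_restrict_mem (measurableSet_memInterval ℓ)] with τ hτ
  have hp := hμ.pos τ hτ
  have h1 : nu μ τ * ‖ξ τ‖ ^ 2 = ‖ξ τ‖ ^ 2 / μ τ := by simp [nu]; ring
  simp only [Pi.add_apply, h1]
  rw [← sub_nonneg]
  have : μ τ + ‖ξ τ‖ ^ 2 / μ τ - ‖ξ τ‖
      = ((μ τ - ‖ξ τ‖ / 2) ^ 2 + 3 / 4 * ‖ξ τ‖ ^ 2) / μ τ := by
    field_simp; ring
  rw [this]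
  positivity

variable [NormedSpace ℝ X]

/-- The linear map `ξ ↦ ∫_Ω ξ(τ) dτ` on `L²_ν(Ω; X)` (the integral converges absolutely). -/
noncomputable def integralMap (hμ : IsMemoryKernel ℓ μ) : StateSpace ℓ μ X →ₗ[ℝ] X where
  toFun ξ := ∫ τ in memInterval ℓ, ξ τ
  map_add' ξ η := by
    rw [← integral_add (hμ.integrable_coe ξ) (hμ.integrable_coe η)]
    exact integral_congr_ae (hμ.ac_stateMeasure.ae_eq (Lp.coeFn_add ξ η))
  map_smul' c ξ := by
    rw [RingHom.id_apply, ← integral_smul]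
    exact integral_congr_ae (hμ.ac_stateMeasure.ae_eq (Lp.coeFn_smul c ξ))

theorem memLp_kernel_smul (hμ : IsMemoryKernel ℓ μ) (v : X) : MemLp (fun τ => μ τ • v) 2 (stateMeasure ℓ μ) := by
  refine (hμ.memLp_iff (hμ.aemeasurable.aestronglyMeasurable.smul_const v)).2 ?_
  refine (hμ.integrable.mul_const (‖v‖ ^ 2)).congr ?_
  filter_upwards [ae_restrict_mem (measurableSet_memInterval ℓ)] with τ hτ
  have hp := hμ.pos τ hτ
  rw [norm_smul, nu, Real.norm_eq_abs, mul_pow, sq_abs]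
  field_simp

/-- The linear map `v ↦ μ v`, that is `(μ v)(τ) = μ(τ) v`, from `X` to `L²_ν(Ω; X)`. -/
noncomputable def kernelMul (hμ : IsMemoryKernel ℓ μ) : X →ₗ[ℝ] StateSpace ℓ μ X where
  toFun v := (hμ.memLp_kernel_smul v).toLp _
  map_add' v w := by
    rw [← MemLp.toLp_add]
    exact MemLp.toLp_congr _ _ (Eventually.of_forall fun τ => smul_add _ _ _)
  map_smul' c v := by
    rw [RingHom.id_apply, ← MemLp.toLp_const_smul]
    exact MemLp.toLp_congr _ _ (Eventually.of_forall fun τ => smul_comm _ _ _)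

end IsMemoryKernel

end Kernel

section Derivative

variable {X : Type*} [NormedAddCommGroup X] [NormedSpace ℝ X]

/-- `g` is the distributional derivative of `ξ` on the open interval `Ω`. -/
def IsDistribDeriv (ℓ : EReal) (ξ g : ℝ → X) : Prop :=
  ∀ φ : ℝ → ℝ, ContDiff ℝ ∞ φ → HasCompactSupport φ → tsupport φ ⊆ memInterval ℓ →
    ∫ τ in memInterval ℓ, deriv φ τ • ξ τ = -∫ τ in memInterval ℓ, φ τ • g τ

/-- `f` is a representative of `ξ` which is continuous on `Ω`. -/
structure IsContRep (ℓ : EReal) (f ξ : ℝ → X) : Prop where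
  continuousOn : ContinuousOn f (memInterval ℓ)
  ae_eq : f =ᵐ[volume.restrict (memInterval ℓ)] ξ

/-- `ξ(ℓ) = lim_{τ → ℓ} ξ(τ) = 0`, the limit being that of the continuous representative. -/
def VanishesAtEnd (ℓ : EReal) (ξ : ℝ → X) : Prop :=
  ∃ f : ℝ → X, IsContRep ℓ f ξ ∧ Tendsto f (rightEnd ℓ) (𝓝 0)

namespace IsMemoryKernel

variable {ℓ : EReal} {μ : ℝ → ℝ}

theorem integrable_smul (hμ : IsMemoryKernel ℓ μ) {φ : ℝ → ℝ} (hφ : Continuous φ) (hc : HasCompactSupport φ)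
    (ξ : StateSpace ℓ μ X) : IntegrableOn (fun τ => φ τ • ξ τ) (memInterval ℓ) := by
  obtain ⟨C, hC⟩ := hφ.bounded_above_of_compact_support hc
  exact (hμ.integrable_coe ξ).bdd_smul C hφ.aestronglyMeasurable (Eventually.of_forall hC)

theorem isDistribDeriv_add (hμ : IsMemoryKernel ℓ μ) {ξ η g h : StateSpace ℓ μ X} (h1 : IsDistribDeriv ℓ ξ g)
    (h2 : IsDistribDeriv ℓ η h) :
    IsDistribDeriv ℓ (ξ + η : StateSpace ℓ μ X) (g + h : StateSpace ℓ μ X) := by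
  intro φ hφ hc hs
  have e1 : ∫ τ in memInterval ℓ, deriv φ τ • (ξ + η : StateSpace ℓ μ X) τ =
      (∫ τ in memInterval ℓ, deriv φ τ • ξ τ) + ∫ τ in memInterval ℓ, deriv φ τ • η τ := by
    have hd : Continuous (deriv φ) := hφ.continuous_deriv (by simp)
    rw [← integral_add (hμ.integrable_smul hd hc.deriv ξ) (hμ.integrable_smul hd hc.deriv η)]
    refine integral_congr_ae ?_
    filter_upwards [hμ.ac_stateMeasure.ae_eq (Lp.coeFn_add ξ η)] with τ hτ
    rw [hτ, Pi.add_apply, smul_add]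
  have e2 : ∫ τ in memInterval ℓ, φ τ • (g + h : StateSpace ℓ μ X) τ =
      (∫ τ in memInterval ℓ, φ τ • g τ) + ∫ τ in memInterval ℓ, φ τ • h τ := by
    rw [← integral_add (hμ.integrable_smul hφ.continuous hc g)
      (hμ.integrable_smul hφ.continuous hc h)]
    refine integral_congr_ae ?_
    filter_upwards [hμ.ac_stateMeasure.ae_eq (Lp.coeFn_add g h)] with τ hτ
    rw [hτ, Pi.add_apply, smul_add]
  rw [e1, e2, h1 φ hφ hc hs, h2 φ hφ hc hs, neg_add]

theorem isDistribDeriv_smul (hμ : IsMemoryKernel ℓ μ) (c : ℝ) {ξ g : StateSpace ℓ μ X} (h1 : IsDistribDeriv ℓ ξ g) :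
    IsDistribDeriv ℓ (c • ξ : StateSpace ℓ μ X) (c • g : StateSpace ℓ μ X) := by
  intro φ hφ hc hs
  have key : ∀ (ψ : ℝ → ℝ) (ζ : StateSpace ℓ μ X),
      ∫ τ in memInterval ℓ, ψ τ • (c • ζ : StateSpace ℓ μ X) τ =
      c • ∫ τ in memInterval ℓ, ψ τ • ζ τ := by
    intro ψ ζ
    rw [← integral_smul]
    refine integral_congr_ae ?_
    filter_upwards [hμ.ac_stateMeasure.ae_eq (Lp.coeFn_smul c ζ)] with τ hτ
    rw [hτ, Pi.smul_apply, smul_comm]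
  rw [key, key, h1 φ hφ hc hs, smul_neg]

theorem isDistribDeriv_zero (hμ : IsMemoryKernel ℓ μ) :
    IsDistribDeriv ℓ (0 : StateSpace ℓ μ X) (0 : StateSpace ℓ μ X) := by
  intro φ hφ hc hs
  have key : ∀ (ψ : ℝ → ℝ), ∫ τ in memInterval ℓ, ψ τ • (0 : StateSpace ℓ μ X) τ = 0 := by
    intro ψ
    rw [integral_eq_zero_of_ae]
    filter_upwards [hμ.ac_stateMeasure.ae_eq (Lp.coeFn_zero X 2 (stateMeasure ℓ μ))] with τ hτ
    rw [hτ]; simp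
  rw [key, key, neg_zero]

theorem isDistribDeriv_unique (hμ : IsMemoryKernel ℓ μ) [CompleteSpace X] {ξ g h : StateSpace ℓ μ X}
    (h1 : IsDistribDeriv ℓ ξ g) (h2 : IsDistribDeriv ℓ ξ h) : g = h := by
  have hz : ∀ᵐ τ, τ ∈ memInterval ℓ → (g τ - h τ) = 0 := by
    refine (isOpen_memInterval ℓ).ae_eq_zero_of_integral_contDiff_smul_eq_zero
      ((hμ.integrable_coe g).sub (hμ.integrable_coe h)).locallyIntegrableOn ?_
    intro φ hφ hc hs
    have e := (h1 φ hφ hc hs).symm.trans (h2 φ hφ hc hs)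
    rw [neg_inj] at e
    have hset : ∫ τ, φ τ • (g τ - h τ) = ∫ τ in memInterval ℓ, φ τ • (g τ - h τ) := by
      refine (setIntegral_eq_integral_of_forall_compl_eq_zero fun τ hτ => ?_).symm
      rw [image_eq_zero_of_notMem_tsupport fun h' => hτ (hs h'), zero_smul]
    rw [hset]
    simp only [smul_sub]
    rw [integral_sub (hμ.integrable_smul hφ.continuous hc g)
      (hμ.integrable_smul hφ.continuous hc h), e, sub_self]
  refine Lp.ext ((stateMeasure_ac ℓ μ).ae_eq ?_)
  rw [EventuallyEq, ae_restrict_iff' (measurableSet_memInterval ℓ)]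
  filter_upwards [hz] with τ hτ hm
  exact sub_eq_zero.1 (hτ hm)

/-- `D(P) = {ξ ∈ L²_ν(Ω; X) | Dξ ∈ L²_ν(Ω; X), ξ(ℓ) = 0}`. -/
noncomputable def derivDomain (hμ : IsMemoryKernel ℓ μ) : Submodule ℝ (StateSpace ℓ μ X) where
  carrier := {ξ | (∃ g : StateSpace ℓ μ X, IsDistribDeriv ℓ ξ g) ∧ VanishesAtEnd ℓ ξ}
  zero_mem' := ⟨⟨0, hμ.isDistribDeriv_zero⟩, fun _ => 0, ⟨continuousOn_const,
    (hμ.ac_stateMeasure.ae_eq (Lp.coeFn_zero X 2 (stateMeasure ℓ μ))).symm⟩, tendsto_const_nhds⟩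
  add_mem' := by
    rintro ξ η ⟨⟨g, hg⟩, f, hf, hf0⟩ ⟨⟨h, hh⟩, k, hk, hk0⟩
    refine ⟨⟨g + h, hμ.isDistribDeriv_add hg hh⟩, fun τ => f τ + k τ,
      ⟨hf.continuousOn.add hk.continuousOn, ?_⟩, by simpa using hf0.add hk0⟩
    exact (hf.ae_eq.add hk.ae_eq).trans (hμ.ac_stateMeasure.ae_eq (Lp.coeFn_add ξ η)).symm
  smul_mem' := by
    rintro c ξ ⟨⟨g, hg⟩, f, hf, hf0⟩
    refine ⟨⟨c • g, hμ.isDistribDeriv_smul c hg⟩, fun τ => c • f τ,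
      ⟨hf.continuousOn.const_smul c, ?_⟩, by simpa using hf0.const_smul c⟩
    exact (hf.ae_eq.const_smul c).trans (hμ.ac_stateMeasure.ae_eq (Lp.coeFn_smul c ξ)).symm

/-- The operator `P ξ = D ξ` with domain `D(P)`. -/
noncomputable def derivOp (hμ : IsMemoryKernel ℓ μ) [CompleteSpace X] : StateSpace ℓ μ X →ₗ.[ℝ] StateSpace ℓ μ X where
  domain := hμ.derivDomain
  toFun :=
    { toFun := fun ξ => Classical.choose ξ.2.1
      map_add' := fun ξ η => hμ.isDistribDeriv_unique (Classical.choose_spec (ξ + η).2.1)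
        (hμ.isDistribDeriv_add (Classical.choose_spec ξ.2.1) (Classical.choose_spec η.2.1))
      map_smul' := fun c ξ => hμ.isDistribDeriv_unique (Classical.choose_spec (c • ξ).2.1)
        (hμ.isDistribDeriv_smul c (Classical.choose_spec ξ.2.1)) }

theorem derivOp_spec (hμ : IsMemoryKernel ℓ μ) [CompleteSpace X] (ξ : (hμ.derivOp (X := X)).domain) :
    IsDistribDeriv ℓ (ξ : StateSpace ℓ μ X) (hμ.derivOp ξ) :=
  Classical.choose_spec ξ.2.1

end IsMemoryKernel

end Derivative

section ExtendedStateSpace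

variable {H : Type*} [NormedAddCommGroup H] [InnerProductSpace ℝ H] [CompleteSpace H]
  {A : H →ₗ.[ℝ] H}

/-- The extended state space `V × H × L²_ν(Ω; V)`, with the Hilbert norm
`‖(u, v, ξ)‖² = ‖u‖_V² + ‖v‖_H² + ‖ξ‖²`. -/
abbrev ExtendedStateSpace (hA : IsStrictlyPositiveOp A) (ℓ : EReal) (μ : ℝ → ℝ) : Type _ :=
  WithLp 2 (EnergySpace hA × WithLp 2 (H × StateSpace ℓ μ (EnergySpace hA)))

namespace ExtendedStateSpace

variable {hA : IsStrictlyPositiveOp A} {ℓ : EReal} {μ : ℝ → ℝ}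

/-- The first component `u` of `(u, v, ξ)`. -/
def displ (z : ExtendedStateSpace hA ℓ μ) : EnergySpace hA := z.fst

/-- The second component `v` of `(u, v, ξ)`. -/
def veloc (z : ExtendedStateSpace hA ℓ μ) : H := z.snd.fst

/-- The third component `ξ` of `(u, v, ξ)`. -/
def state (z : ExtendedStateSpace hA ℓ μ) : StateSpace ℓ μ (EnergySpace hA) := z.snd.snd

/-- The element `(u, v, ξ)`. -/
def triple (u : EnergySpace hA) (v : H) (ξ : StateSpace ℓ μ (EnergySpace hA)) :
    ExtendedStateSpace hA ℓ μ := WithLp.toLp 2 (u, WithLp.toLp 2 (v, ξ))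

theorem norm_sq (z : ExtendedStateSpace hA ℓ μ) :
    ‖z‖ ^ 2 = ‖z.displ‖ ^ 2 + ‖z.veloc‖ ^ 2 + ‖z.state‖ ^ 2 := by
  rw [WithLp.prod_norm_sq_eq_of_L2, WithLp.prod_norm_sq_eq_of_L2 z.snd, ← add_assoc]
  rfl

end ExtendedStateSpace

open ExtendedStateSpace

variable (hA : IsStrictlyPositiveOp A) {ℓ : EReal} {μ : ℝ → ℝ} (hμ : IsMemoryKernel ℓ μ)

/-- The domain of the operator of the evolution equation: the `(u, v, ξ)` with `v ∈ V`,
`u + ∫_Ω ξ(τ) dτ ∈ D(A)` and `ξ ∈ D(P)`. -/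
noncomputable def generatorDomain : Submodule ℝ (ExtendedStateSpace hA ℓ μ) where
  carrier := {z | z.veloc ∈ (sqrtOp hA).domain ∧
    EnergySpace.incl hA (z.displ + hμ.integralMap z.state) ∈ A.domain ∧
    z.state ∈ (hμ.derivOp (X := EnergySpace hA)).domain}
  zero_mem' := by
    refine ⟨Submodule.zero_mem _, ?_, Submodule.zero_mem _⟩
    simp [displ, state]
  add_mem' := by
    rintro z w ⟨h1, h2, h3⟩ ⟨k1, k2, k3⟩
    refine ⟨Submodule.add_mem _ h1 k1, ?_, Submodule.add_mem _ h3 k3⟩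
    convert Submodule.add_mem _ h2 k2 using 1
    simp only [displ, state, WithLp.add_fst, WithLp.add_snd, map_add]
    abel
  smul_mem' := by
    rintro c z ⟨h1, h2, h3⟩
    refine ⟨Submodule.smul_mem _ c h1, ?_, Submodule.smul_mem _ c h3⟩
    convert Submodule.smul_mem _ c h2 using 1
    simp only [displ, state, WithLp.smul_fst, WithLp.smul_snd, map_smul, map_add, smul_add]

theorem veloc_mem {z : ExtendedStateSpace hA ℓ μ} (h : z ∈ generatorDomain hA hμ) :
    z.veloc ∈ (sqrtOp hA).domain := h.1

theorem integral_mem {z : ExtendedStateSpace hA ℓ μ} (h : z ∈ generatorDomain hA hμ) :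
    EnergySpace.incl hA (z.displ + hμ.integralMap z.state) ∈ A.domain := h.2.1

theorem state_mem {z : ExtendedStateSpace hA ℓ μ} (h : z ∈ generatorDomain hA hμ) :
    z.state ∈ (hμ.derivOp (X := EnergySpace hA)).domain := h.2.2

/-- The operator `(u, v, ξ) ↦ (v, -A[u + ∫_Ω ξ(τ) dτ], P ξ + μ v)`. -/
noncomputable def generatorOp :
    ExtendedStateSpace hA ℓ μ →ₗ.[ℝ] ExtendedStateSpace hA ℓ μ where
  domain := generatorDomain hA hμ
  toFun :=
    { toFun := fun z => triple
        (EnergySpace.mk hA z.1.veloc (veloc_mem hA hμ z.2))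
        (-A ⟨EnergySpace.incl hA (z.1.displ + hμ.integralMap z.1.state), (integral_mem hA hμ z.2)⟩)
        (hμ.derivOp ⟨z.1.state, (state_mem hA hμ z.2)⟩ +
          hμ.kernelMul (EnergySpace.mk hA z.1.veloc (veloc_mem hA hμ z.2)))
      map_add' := by
        intro z w
        have e1 : EnergySpace.mk hA (z + w).1.veloc (veloc_mem hA hμ (z + w).2) =
            EnergySpace.mk hA z.1.veloc (veloc_mem hA hμ z.2) + EnergySpace.mk hA w.1.veloc (veloc_mem hA hμ w.2) := rfl
        have e2 : A ⟨EnergySpace.incl hA ((z + w).1.displ + hμ.integralMap (z + w).1.state),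
              (integral_mem hA hμ (z + w).2)⟩ =
            A ⟨EnergySpace.incl hA (z.1.displ + hμ.integralMap z.1.state), (integral_mem hA hμ z.2)⟩ +
            A ⟨EnergySpace.incl hA (w.1.displ + hμ.integralMap w.1.state), (integral_mem hA hμ w.2)⟩ := by
          rw [← LinearPMap.map_add]
          congr 1
          apply Subtype.ext
          simp only [displ, state, Submodule.coe_add, WithLp.add_fst, WithLp.add_snd, map_add]
          abel
        have e3 : hμ.derivOp ⟨(z + w).1.state, (state_mem hA hμ (z + w).2)⟩ =
            hμ.derivOp ⟨z.1.state, (state_mem hA hμ z.2)⟩ + hμ.derivOp ⟨w.1.state, (state_mem hA hμ w.2)⟩ := by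
          rw [← LinearPMap.map_add]
          rfl
        rw [e1, e2, e3, map_add hμ.kernelMul]
        simp only [triple, ← WithLp.toLp_add, Prod.mk_add_mk]
        congr 4
        · abel
        · abel
      map_smul' := by
        intro c z
        have e1 : EnergySpace.mk hA (c • z).1.veloc (veloc_mem hA hμ (c • z).2) =
            c • EnergySpace.mk hA z.1.veloc (veloc_mem hA hμ z.2) := rfl
        have e2 : A ⟨EnergySpace.incl hA ((c • z).1.displ + hμ.integralMap (c • z).1.state),
              (integral_mem hA hμ (c • z).2)⟩ =
            c • A ⟨EnergySpace.incl hA (z.1.displ + hμ.integralMap z.1.state), (integral_mem hA hμ z.2)⟩ := by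
          rw [← LinearPMap.map_smul]
          congr 1
          apply Subtype.ext
          simp only [displ, state, Submodule.coe_smul, WithLp.smul_fst, WithLp.smul_snd, map_smul,
            map_add, smul_add]
        have e3 : hμ.derivOp ⟨(c • z).1.state, (state_mem hA hμ (c • z).2)⟩ =
            c • hμ.derivOp ⟨z.1.state, (state_mem hA hμ z.2)⟩ := by
          rw [← LinearPMap.map_smul]
          rfl
        rw [e1, e2, e3, map_smul hμ.kernelMul, RingHom.id_apply]
        simp only [triple, ← WithLp.toLp_smul, Prod.smul_mk, smul_add, smul_neg] }

end ExtendedStateSpace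

section Semigroup

variable {E : Type*} [NormedAddCommGroup E] [NormedSpace ℝ E]

/-- A strongly continuous semigroup of linear contractions. -/
structure IsContractionSemigroup (S : ℝ≥0 → E →L[ℝ] E) : Prop where
  zero : S 0 = ContinuousLinearMap.id ℝ E
  add : ∀ s t, S (s + t) = (S s).comp (S t)
  continuous : ∀ z, Continuous fun t => S t z
  contraction : ∀ t, ‖S t‖ ≤ 1

/-- `T` is the infinitesimal generator of `S`: `z ∈ D(T)` with `T z = y` exactly when
`(S(h) z - z) / h → y` as `h → 0`, `h > 0`. -/
def HasGenerator (S : ℝ≥0 → E →L[ℝ] E) (T : E →ₗ.[ℝ] E) : Prop :=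
  ∀ z y : E, (∃ h : z ∈ T.domain, T ⟨z, h⟩ = y) ↔
    Tendsto (fun h : ℝ≥0 => (h : ℝ)⁻¹ • (S h z - z)) (𝓝[>] 0) (𝓝 y)

/-- `Z ∈ C([0, ∞), E)` is a mild solution of `Z' = T Z`, `Z(0) = z`: for every `t ≥ 0`,
`∫₀ᵗ Z(s) ds ∈ D(T)` and `Z(t) = z + T ∫₀ᵗ Z(s) ds`. -/
structure IsMildSolution (T : E →ₗ.[ℝ] E) (z : E) (Z : ℝ → E) : Prop where
  continuousOn : ContinuousOn Z (Ici 0)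
  integral_eq : ∀ t : ℝ, 0 ≤ t →
    ∃ h : (∫ s in (0 : ℝ)..t, Z s) ∈ T.domain, Z t = z + T ⟨∫ s in (0 : ℝ)..t, Z s, h⟩

end Semigroup

end StateMemory

/-! The operator `generatorOp` is maximal dissipative, and the energy equality is its dissipativity
computed without loss.

In `⟪𝔸 z, z⟫` the terms in `u`, `v` and `∫ ξ` cancel: `⟪A w, v⟫_H = ⟪w, v⟫_V` for `w = u + ∫ ξ`,
while `⟪μ v, ξ⟫ = ⟪v, ∫ ξ⟫_V` because `μ ν = 1`. Only `⟪P ξ, ξ⟫` survives (`inner_generatorOp`).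
Since `μ` is summable, `L²_ν` embeds in `L¹`; so every `ξ ∈ D(P)` is minus the tail integral of `Dξ`
(`ae_eq_neg_tail`) and is continuous up to `0`. Integrating the derivative of `ν ‖ξ‖²` over compact
intervals exhausting `Ω` then gives `2 ⟪P ξ, ξ⟫ = -ν(0) ‖ξ(0)‖² - ∫ ν' ‖ξ‖²`. This is
`IsMemoryKernel.energy_identity`, and it is nonpositive since `ν` is nondecreasing. The delicate
point is the boundary term at `ℓ`: it tends to zero along a suitable sequence
(`exists_seq_energy_tendsto_zero`).

For the range condition, `c - P` is inverted by an explicit exponential kernel, bounded in `L²_ν` by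
the monotonicity of `μ` and a convolution estimate (`memLp_expTail`). Eliminating `u` and `ξ` from
`c z - 𝔸 z = y` leaves an equation `λ w + A w = f` with `λ > 0`, solvable because `A` is positive
with bounded inverse (`generatorOp_surjective`).

The rest is the Hille–Yosida theory of maximal dissipative operators on a Hilbert space. Yosida
approximations give the semigroup; dissipativity makes mild solutions unique, hence also the
semigroup. On the domain, `‖S(t) z‖²` has derivative `2 ⟪𝔸 S(t) z, S(t) z⟫`, to which the energy
identity applies. -/

namespace StateMemory

/-! ### The interval `Ω` and the filter at its right end. -/

section RightEnd

variable {ℓ : EReal}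

instance : (rightEnd ℓ).IsCountablyGenerated := by
  unfold rightEnd; infer_instance

theorem rightEnd_neBot (hℓ : 0 < ℓ) : (rightEnd ℓ).NeBot := by
  refine comap_neBot fun t ht => ?_
  obtain ⟨l, hl, hlt⟩ := (mem_nhdsLT_iff_exists_Ioo_subset' hℓ).1 ht
  obtain ⟨x, h1, h2⟩ := EReal.lt_iff_exists_real_btwn.1 hl
  exact ⟨x, hlt ⟨h1, h2⟩⟩

theorem eventually_lt_rightEnd {s : ℝ} (hs : (s : EReal) < ℓ) : ∀ᶠ τ in rightEnd ℓ, s < τ := by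
  have : ∀ᶠ x : EReal in 𝓝[<] ℓ, (s : EReal) < x := mem_nhdsWithin_of_mem_nhds (Ioi_mem_nhds hs)
  filter_upwards [this.comap (fun s : ℝ => (s : EReal))] with τ hτ
  exact_mod_cast hτ

theorem eventually_lt_end : ∀ᶠ τ : ℝ in rightEnd ℓ, (τ : EReal) < ℓ := by
  have : ∀ᶠ x : EReal in 𝓝[<] ℓ, x < ℓ := self_mem_nhdsWithin
  exact this.comap _

theorem eventually_mem_rightEnd (hℓ : 0 < ℓ) : ∀ᶠ τ in rightEnd ℓ, τ ∈ memInterval ℓ := by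
  filter_upwards [eventually_lt_rightEnd (s := 0) (by simpa using hℓ), eventually_lt_end (ℓ := ℓ)]
    with τ h1 h2 using ⟨h1, h2⟩

theorem eventually_mem_nhdsGT (hℓ : 0 < ℓ) : ∀ᶠ τ in 𝓝[>] (0 : ℝ), τ ∈ memInterval ℓ := by
  have : ∀ᶠ τ : ℝ in 𝓝 0, (τ : EReal) < ℓ :=
    continuous_coe_real_ereal.continuousAt.eventually_lt continuousAt_const (by simpa using hℓ)
  filter_upwards [self_mem_nhdsWithin, mem_nhdsWithin_of_mem_nhds this] with τ h1 h2 using ⟨h1, h2⟩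

theorem ordConnected_memInterval (ℓ : EReal) : OrdConnected (memInterval ℓ) := by
  refine ⟨fun a ha b hb x hx => ⟨ha.1.trans_le hx.1, lt_of_le_of_lt ?_ hb.2⟩⟩
  exact_mod_cast hx.2

theorem Icc_subset_memInterval {a b : ℝ} (ha : a ∈ memInterval ℓ) (hb : b ∈ memInterval ℓ) :
    Icc a b ⊆ memInterval ℓ := (ordConnected_memInterval ℓ).out ha hb

theorem exists_Icc_of_isCompact (hℓ : 0 < ℓ) {k : Set ℝ} (hk : IsCompact k)
    (hs : k ⊆ memInterval ℓ) :
    ∃ a ∈ memInterval ℓ, ∃ b ∈ memInterval ℓ, a ≤ b ∧ k ⊆ Icc a b := by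
  rcases k.eq_empty_or_nonempty with rfl | hne
  · obtain ⟨a, ha⟩ := (eventually_mem_nhdsGT hℓ).exists
    exact ⟨a, ha, a, ha, le_rfl, empty_subset _⟩
  · refine ⟨sInf k, hs (hk.sInf_mem hne), sSup k, hs (hk.sSup_mem hne), ?_, fun x hx => ?_⟩
    · exact csInf_le_csSup hne hk.bddBelow hk.bddAbove
    · exact ⟨csInf_le hk.bddBelow hx, le_csSup hk.bddAbove hx⟩

end RightEnd

/-! ### Tail integrals of integrable functions. -/

section Tail

variable {X : Type*} [NormedAddCommGroup X] [NormedSpace ℝ X]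

/-- The tail integral `τ ↦ ∫_τ^∞ g(s) ds`. -/
noncomputable def tail (g : ℝ → X) (τ : ℝ) : X := ∫ s in Ioi τ, g s

theorem tail_sub_tail {g : ℝ → X} (hg : Integrable g) (a b : ℝ) :
    tail g a - tail g b = ∫ s in a..b, g s :=
  intervalIntegral.integral_Ioi_sub_Ioi' hg.integrableOn hg.integrableOn

theorem tail_eq {g : ℝ → X} (hg : Integrable g) (a : ℝ) :
    tail g = fun τ => tail g a - ∫ s in a..τ, g s := by
  ext τ
  rw [← tail_sub_tail hg, sub_sub_cancel]

theorem continuous_tail {g : ℝ → X} (hg : Integrable g) : Continuous (tail g) := by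
  rw [tail_eq hg 0]
  exact continuous_const.sub (intervalIntegral.continuous_primitive
    (fun _ _ => hg.intervalIntegrable) 0)

theorem norm_tail_le {g : ℝ → X} (hg : Integrable g) (τ : ℝ) : ‖tail g τ‖ ≤ ∫ s, ‖g s‖ :=
  (norm_integral_le_integral_norm _).trans
    (setIntegral_le_integral hg.norm (Eventually.of_forall fun _ => norm_nonneg _))

theorem norm_tail_sub_le {g : ℝ → X} (hg : Integrable g) (a b : ℝ) :
    ‖tail g a - tail g b‖ ≤ |tail (fun s => ‖g s‖) a - tail (fun s => ‖g s‖) b| := by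
  rw [tail_sub_tail hg, tail_sub_tail hg.norm]
  exact intervalIntegral.norm_integral_le_abs_integral_norm

theorem ae_hasDerivAt_tail [CompleteSpace X] {g : ℝ → X} (hg : Integrable g) :
    ∀ᵐ τ, HasDerivAt (tail g) (-g τ) τ := by
  filter_upwards [LocallyIntegrable.ae_hasDerivAt_integral hg.locallyIntegrable] with τ hτ
  rw [tail_eq hg 0]
  exact (hτ 0).const_sub _

/-- Dominated convergence: each point of `Ω` is eventually passed by `τ`, and outside `Ω` the
integrand is zero. -/
theorem tendsto_tail_rightEnd {ℓ : EReal} {g : ℝ → X} (hg : Integrable g)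
    (hz : ∀ s, s ∉ memInterval ℓ → g s = 0) : Tendsto (tail g) (rightEnd ℓ) (𝓝 0) := by
  have h0 : (0 : X) = ∫ _ : ℝ, (0 : X) := by simp
  have he : tail g = fun τ => ∫ s, (Ioi τ).indicator g s := by
    ext τ; rw [integral_indicator measurableSet_Ioi]; rfl
  rw [he, h0]
  refine tendsto_integral_filter_of_dominated_convergence (fun s => ‖g s‖)
    (Eventually.of_forall fun τ => hg.aestronglyMeasurable.indicator measurableSet_Ioi)
    (Eventually.of_forall fun τ => Eventually.of_forall fun s => norm_indicator_le_norm_self _ _)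
    hg.norm (Eventually.of_forall fun s => ?_)
  by_cases hs : s ∈ memInterval ℓ
  · refine tendsto_const_nhds.congr' ?_
    filter_upwards [eventually_lt_rightEnd hs.2] with τ hτ
    rw [indicator_of_notMem (by simpa using hτ.le)]
  · refine tendsto_const_nhds.congr fun τ => ?_
    by_cases h : s ∈ Ioi τ
    · rw [indicator_of_mem h, hz s hs]
    · rw [indicator_of_notMem h]

/-- Integration by parts against a test function. -/
theorem integral_deriv_smul_tail [CompleteSpace X] {g : ℝ → X} (hg : Integrable g) {φ : ℝ → ℝ}
    (hφ : ContDiff ℝ ∞ φ) (hc : HasCompactSupport φ) :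
    ∫ τ, deriv φ τ • tail g τ = ∫ s, φ s • g s := by
  have hd : Integrable (deriv φ) :=
    (hφ.continuous_deriv (by simp)).integrable_of_hasCompactSupport hc.deriv
  -- Both sides are the integral of `φ'(τ) g(s)` over the half-plane `τ < s`, taken in the two
  -- possible orders.
  have hm : MeasurableSet {p : ℝ × ℝ | p.1 < p.2} := measurableSet_lt measurable_fst measurable_snd
  have hint : Integrable (Function.uncurry fun τ s : ℝ =>
      {p : ℝ × ℝ | p.1 < p.2}.indicator (fun p => deriv φ p.1 • g p.2) (τ, s))
      (volume.prod volume) := (hd.smul_prod hg).indicator hm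
  have e1 : ∀ τ, ∫ s, {p : ℝ × ℝ | p.1 < p.2}.indicator (fun p => deriv φ p.1 • g p.2) (τ, s) =
      deriv φ τ • tail g τ := by
    intro τ
    rw [tail, ← integral_smul, ← integral_indicator measurableSet_Ioi]
    rfl
  have e2 : ∀ s, ∫ τ, {p : ℝ × ℝ | p.1 < p.2}.indicator (fun p => deriv φ p.1 • g p.2) (τ, s) =
      φ s • g s := by
    intro s
    rw [← HasCompactSupport.integral_Iic_deriv_eq (hφ.of_le (by simp)) hc s,
      integral_Iic_eq_integral_Iio, ← integral_smul_const, ← integral_indicator measurableSet_Iio]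
    rfl
  simp_rw [← e1, ← e2]
  exact integral_integral_swap hint

end Tail

/-! ### Distributional derivatives on `Ω` and recovery of a function from its derivative. -/

section DistribDeriv

variable {X : Type*} [NormedAddCommGroup X] [NormedSpace ℝ X] {ℓ : EReal}

theorem setIntegral_smul_eq {φ : ℝ → ℝ} (hs : tsupport φ ⊆ memInterval ℓ) (f : ℝ → X) :
    ∫ τ in memInterval ℓ, φ τ • f τ = ∫ τ, φ τ • f τ :=
  setIntegral_eq_integral_of_forall_compl_eq_zero fun τ hτ => by
    rw [image_eq_zero_of_notMem_tsupport fun h' => hτ (hs h'), zero_smul]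

theorem isDistribDeriv_tail [CompleteSpace X] {g : ℝ → X} (hg : Integrable g) :
    IsDistribDeriv ℓ (tail g) (fun τ => -g τ) := by
  intro φ hφ hc hs
  rw [setIntegral_smul_eq ((tsupport_deriv_subset).trans hs), setIntegral_smul_eq hs,
    integral_deriv_smul_tail hg hφ hc, ← integral_neg]
  simp

/-- A primitive of a test function of zero mean is a test function. -/
theorem exists_testFunction_primitive (hℓ : 0 < ℓ) {η : ℝ → ℝ} (hη : ContDiff ℝ ∞ η)
    (hc : HasCompactSupport η) (hs : tsupport η ⊆ memInterval ℓ) (h0 : ∫ s, η s = 0) :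
    ∃ ψ : ℝ → ℝ, ContDiff ℝ ∞ ψ ∧ HasCompactSupport ψ ∧ tsupport ψ ⊆ memInterval ℓ ∧
      deriv ψ = η := by
  obtain ⟨a, ha, b, hb, hab, hsub⟩ := exists_Icc_of_isCompact hℓ hc hs
  have hi : Integrable η := hη.continuous.integrable_of_hasCompactSupport hc
  have hz : ∀ s, s ∉ Icc a b → η s = 0 := fun s h =>
    image_eq_zero_of_notMem_tsupport fun h' => h (hsub h')
  let ψ : ℝ → ℝ := fun τ => ∫ s in a..τ, η s
  have hd : ∀ τ, HasDerivAt ψ (η τ) τ := fun τ =>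
    intervalIntegral.integral_hasDerivAt_right hi.intervalIntegrable
      (hη.continuous.stronglyMeasurableAtFilter _ _) hη.continuous.continuousAt
  have hde : deriv ψ = η := funext fun τ => (hd τ).deriv
  have hψ : Function.support ψ ⊆ Icc a b := by
    intro τ hτ
    by_contra hn
    apply hτ
    rcases lt_or_ge τ a with h | h
    · refine intervalIntegral.integral_zero_ae (Eventually.of_forall fun s hs => ?_)
      rw [uIoc_of_ge h.le] at hs
      rcases hs.2.lt_or_eq with h1 | h1
      · exact hz s fun h2 => absurd h2.1 (not_le.2 h1)
      -- The endpoint `s = a` belongs to `Icc a b`, so the support gives nothing there; `η a = 0` by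
      -- continuity from the left.
      · have hcl : IsClosed {x | η x = 0} := isClosed_eq hη.continuous continuous_const
        have : Iio a ⊆ {x | η x = 0} := fun x hx => hz x fun h2 => absurd h2.1 (not_le.2 hx)
        have h3 := closure_minimal this hcl
        rw [closure_Iio] at h3
        exact h3 h1.le
    · have h1 : b < τ := by
        by_contra h2
        exact hn ⟨h, not_lt.1 h2⟩
      -- The zero mean enters here: beyond `b` the primitive equals the whole integral of `η`.
      have h4 : ∫ s in Ioi a, η s = 0 := by
        rw [← integral_Ici_eq_integral_Ioi, ← h0]
        exact setIntegral_eq_integral_of_forall_compl_eq_zero fun x hx => hz x fun h2 => hx h2.1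
      have h5 : ∫ s in Ioi τ, η s = 0 := by
        refine setIntegral_eq_zero_of_forall_eq_zero fun x hx => hz x fun h2 => ?_
        exact absurd (h2.2.trans_lt h1) (not_lt.2 (le_of_lt hx))
      have := tail_sub_tail hi a τ
      rw [tail, tail, h4, h5, sub_zero] at this
      exact this.symm
  have hts : tsupport ψ ⊆ Icc a b := closure_minimal hψ isClosed_Icc
  refine ⟨ψ, contDiff_infty_iff_deriv.2 ⟨fun τ => (hd τ).differentiableAt, hde ▸ hη⟩,
    isCompact_Icc.of_isClosed_subset (isClosed_tsupport _) hts,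
    hts.trans (Icc_subset_memInterval ha hb), hde⟩

theorem exists_testFunction_integral_eq_one (hℓ : 0 < ℓ) : ∃ ρ : ℝ → ℝ, ContDiff ℝ ∞ ρ ∧
    HasCompactSupport ρ ∧ tsupport ρ ⊆ memInterval ℓ ∧ ∫ s, ρ s = 1 := by
  obtain ⟨c, hc⟩ := (eventually_mem_nhdsGT hℓ).exists
  obtain ⟨r, hr, hsub⟩ := Metric.isOpen_iff.1 (isOpen_memInterval ℓ) c hc
  let φ : ContDiffBump c := ⟨r / 4, r / 2, by positivity, by linarith⟩
  refine ⟨φ.normed volume, φ.contDiff_normed, φ.hasCompactSupport_normed, ?_, φ.integral_normed⟩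
  rw [φ.tsupport_normed_eq]
  exact (Metric.closedBall_subset_ball (by change r / 2 < r; linarith)).trans hsub

/-- A function with zero distributional derivative is almost everywhere constant. -/
theorem IsDistribDeriv.exists_ae_eq_const [CompleteSpace X] (hℓ : 0 < ℓ) {w : ℝ → X}
    (hw : LocallyIntegrableOn w (memInterval ℓ)) (h : IsDistribDeriv ℓ w fun _ => 0) :
    ∃ c : X, w =ᵐ[volume.restrict (memInterval ℓ)] fun _ => c := by
  obtain ⟨ρ, hρ, hρc, hρs, hρ1⟩ := exists_testFunction_integral_eq_one hℓ
  have hsm : ∀ {φ : ℝ → ℝ}, Continuous φ → HasCompactSupport φ → tsupport φ ⊆ memInterval ℓ →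
      Integrable fun τ => φ τ • w τ := by
    intro φ hφ hc hs
    have h1 : IntegrableOn w (tsupport φ) := hw.integrableOn_compact_subset hs hc
    obtain ⟨C, hC⟩ := hφ.bounded_above_of_compact_support hc
    have h2 : IntegrableOn (fun τ => φ τ • w τ) (tsupport φ) :=
      h1.bdd_smul C hφ.aestronglyMeasurable (Eventually.of_forall hC)
    rwa [integrableOn_iff_integrable_of_support_subset] at h2
    exact (Function.support_smul_subset_left _ _).trans (subset_tsupport φ)
  have hL : LocallyIntegrableOn (fun τ => w τ - ∫ s, ρ s • w s) (memInterval ℓ) :=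
    hw.sub ((locallyIntegrable_const _).locallyIntegrableOn _)
  refine ⟨∫ s, ρ s • w s, ?_⟩
  have key := (isOpen_memInterval ℓ).ae_eq_zero_of_integral_contDiff_smul_eq_zero hL ?_
  · rw [EventuallyEq, ae_restrict_iff' (measurableSet_memInterval ℓ)]
    filter_upwards [key] with τ hτ hm using sub_eq_zero.1 (hτ hm)
  intro φ hφ hc hs
  have hφi : Integrable φ := hφ.continuous.integrable_of_hasCompactSupport hc
  have hρi : Integrable ρ := hρ.continuous.integrable_of_hasCompactSupport hρc
  -- Subtracting `(∫ φ) ρ` from `φ` gives zero mean, so the difference is the derivative of a test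
  -- function. This forces the constant to be `∫ ρ w`.
  have hηs : tsupport (fun s => φ s - (∫ t, φ t) * ρ s) ⊆ memInterval ℓ := by
    refine (tsupport_sub _ _).trans (union_subset hs ?_)
    exact (closure_mono (Function.support_mul_subset_right _ _)).trans hρs
  obtain ⟨ψ, hψ, hψc, hψs, hd⟩ := exists_testFunction_primitive hℓ
    (η := fun s => φ s - (∫ t, φ t) * ρ s) (hφ.sub (contDiff_const.mul hρ))
    (hc.sub hρc.mul_left) hηs (by
      rw [integral_sub hφi (hρi.const_mul _), integral_const_mul, hρ1, mul_one, sub_self])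
  have e := h ψ hψ hψc hψs
  rw [hd, setIntegral_smul_eq hηs] at e
  simp only [smul_zero, integral_zero, neg_zero, sub_smul, mul_smul] at e
  have hρw : Integrable fun τ => (∫ t, φ t) • ρ τ • w τ := (hsm hρ.continuous hρc hρs).smul _
  rw [integral_sub (hsm hφ.continuous hc hs) hρw, integral_smul] at e
  simp only [smul_sub]
  rw [integral_sub (hsm hφ.continuous hc hs) (hφi.smul_const _), integral_smul_const, e]

theorem IsContRep.eqOn_of_ae_eq {Y : Type*} [NormedAddCommGroup Y] {f g ξ : ℝ → Y} (hf : IsContRep ℓ f ξ)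
    (hg : ContinuousOn g (memInterval ℓ)) (h : ξ =ᵐ[volume.restrict (memInterval ℓ)] g) :
    EqOn f g (memInterval ℓ) :=
  Measure.eqOn_of_ae_eq (hf.ae_eq.trans h) hf.continuousOn hg
    (by rw [(isOpen_memInterval ℓ).interior_eq]; exact subset_closure)

/-- A function with integrable distributional derivative `g` which vanishes at the right end is
the tail integral of `-g`. -/
theorem ae_eq_neg_tail [CompleteSpace X] (hℓ : 0 < ℓ) {ξ g : ℝ → X}
    (hξ : IntegrableOn ξ (memInterval ℓ)) (hg : IntegrableOn g (memInterval ℓ))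
    (hd : IsDistribDeriv ℓ ξ g) (hv : VanishesAtEnd ℓ ξ) :
    ξ =ᵐ[volume.restrict (memInterval ℓ)] fun τ => -tail ((memInterval ℓ).indicator g) τ := by
  set G := tail ((memInterval ℓ).indicator g) with hG
  have hgi : Integrable ((memInterval ℓ).indicator g) :=
    (integrable_indicator_iff (measurableSet_memInterval ℓ)).2 hg
  have hGc : Continuous G := continuous_tail hgi
  have hw : LocallyIntegrableOn (fun τ => ξ τ + G τ) (memInterval ℓ) :=
    hξ.locallyIntegrableOn.add (hGc.locallyIntegrable.locallyIntegrableOn _)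
  have hsm : ∀ {φ : ℝ → ℝ}, Continuous φ → HasCompactSupport φ →
      IntegrableOn (fun τ => φ τ • ξ τ) (memInterval ℓ) ∧
      IntegrableOn (fun τ => φ τ • G τ) (memInterval ℓ) := by
    intro φ hφ hc
    obtain ⟨C, hC⟩ := hφ.bounded_above_of_compact_support hc
    exact ⟨hξ.bdd_smul C hφ.aestronglyMeasurable (Eventually.of_forall hC),
      ((hφ.smul hGc).integrable_of_hasCompactSupport hc.smul_right).integrableOn⟩
  obtain ⟨c, hc⟩ := IsDistribDeriv.exists_ae_eq_const hℓ hw (by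
    intro φ hφ hc hs
    obtain ⟨h1, h2⟩ := hsm (hφ.continuous_deriv (by simp)) hc.deriv
    simp only [smul_add, smul_zero, integral_zero, neg_zero]
    have h3 : ∫ τ in memInterval ℓ, φ τ • -(memInterval ℓ).indicator g τ =
        -∫ τ in memInterval ℓ, φ τ • g τ := by
      rw [← integral_neg]
      refine setIntegral_congr_fun (measurableSet_memInterval ℓ) fun τ hτ => ?_
      simp only [indicator_of_mem hτ, smul_neg]
    rw [integral_add h1 h2, hd φ hφ hc hs, isDistribDeriv_tail hgi φ hφ hc hs, h3]
    simp)
  obtain ⟨f, hf, hf0⟩ := hv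
  have hfc : EqOn f (fun τ => c - G τ) (memInterval ℓ) := by
    refine hf.eqOn_of_ae_eq (continuousOn_const.sub hGc.continuousOn) ?_
    filter_upwards [hc] with τ hτ
    rw [← hτ, add_sub_cancel_right]
  have := rightEnd_neBot hℓ
  -- `ξ + G` is a constant `c`, and both the continuous representative of `ξ` and `G` tend to zero
  -- at `ℓ`.
  have hc0 : c = 0 := by
    have h1 : Tendsto (fun τ => f τ + G τ) (rightEnd ℓ) (𝓝 (0 + 0)) :=
      hf0.add (tendsto_tail_rightEnd hgi fun s hs => indicator_of_notMem hs _)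
    rw [add_zero] at h1
    refine tendsto_nhds_unique (tendsto_const_nhds.congr' ?_) h1
    filter_upwards [eventually_mem_rightEnd hℓ] with τ hτ
    rw [hfc hτ, sub_add_cancel]
  filter_upwards [hc] with τ hτ
  rw [eq_neg_iff_add_eq_zero, hτ, hc0]

end DistribDeriv

/-! ### Absolute continuity by comparison of increments. -/

section AbsolutelyContinuous

theorem absolutelyContinuousOnInterval_of_dist_le {X Y : Type*} [PseudoMetricSpace X]
    [PseudoMetricSpace Y] {f : ℝ → X} {h : ℝ → Y} {a b C : ℝ}
    (hf : AbsolutelyContinuousOnInterval f a b)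
    (hle : ∀ x ∈ uIcc a b, ∀ y ∈ uIcc a b, dist (h x) (h y) ≤ C * dist (f x) (f y)) :
    AbsolutelyContinuousOnInterval h a b := by
  have h1 := Tendsto.const_mul C (show Tendsto _ _ _ from hf)
  rw [mul_zero] at h1
  refine squeeze_zero' (Eventually.of_forall fun _ => Finset.sum_nonneg fun _ _ => dist_nonneg) ?_ h1
  rw [eventually_inf_principal]
  filter_upwards with ⟨n, I⟩ hnI
  simp only [Finset.mul_sum]
  exact Finset.sum_le_sum fun i hi => hle _ (hnI.1 i hi).1 _ (hnI.1 i hi).2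

theorem absolutelyContinuousOnInterval_inv {f : ℝ → ℝ} {a b : ℝ}
    (hf : AbsolutelyContinuousOnInterval f a b) (h0 : ∀ x ∈ uIcc a b, 0 < f x) :
    AbsolutelyContinuousOnInterval (fun x => 1 / f x) a b := by
  obtain ⟨z, hz, hmin⟩ := isCompact_uIcc.exists_isMinOn (nonempty_uIcc (a := a) (b := b))
    hf.continuousOn
  have hm := h0 z hz
  refine absolutelyContinuousOnInterval_of_dist_le (C := (f z * f z)⁻¹) hf fun x hx y hy => ?_
  have h1 := h0 x hx
  have h2 := h0 y hy
  have e : 1 / f x - 1 / f y = (f x * f y)⁻¹ * (f y - f x) := by field_simp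
  rw [Real.dist_eq, e, abs_mul, abs_of_pos (by positivity), dist_comm, Real.dist_eq]
  gcongr
  · exact hmin hx
  · exact hmin hy

/-- The increments of `tail g` are dominated by those of the scalar tail of `‖g‖`, and squaring the
norm costs the factor `2 ∫ ‖g‖` because the tail is bounded by `∫ ‖g‖`. -/
theorem absolutelyContinuousOnInterval_norm_sq_tail {X : Type*} [NormedAddCommGroup X]
    [NormedSpace ℝ X] {g : ℝ → X} (hg : Integrable g) (a b : ℝ) :
    AbsolutelyContinuousOnInterval (fun τ => ‖tail g τ‖ ^ 2) a b := by
  have h1 : AbsolutelyContinuousOnInterval (tail fun s => ‖g s‖) a b := by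
    refine absolutelyContinuousOnInterval_of_dist_le (C := 1)
      (hg.norm.intervalIntegrable.absolutelyContinuousOnInterval_intervalIntegral
        (left_mem_uIcc (a := a) (b := b))) fun x _ y _ => ?_
    rw [tail_eq hg.norm a, dist_sub_left, one_mul]
  refine absolutelyContinuousOnInterval_of_dist_le (C := 2 * ∫ s, ‖g s‖) h1 fun x _ y _ => ?_
  have e : ‖tail g x‖ ^ 2 - ‖tail g y‖ ^ 2 =
    (‖tail g x‖ + ‖tail g y‖) * (‖tail g x‖ - ‖tail g y‖) := by ring
  rw [Real.dist_eq, e, abs_mul, abs_of_nonneg (by positivity), Real.dist_eq]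
  refine mul_le_mul ?_ ((abs_norm_sub_norm_le _ _).trans (norm_tail_sub_le hg x y)) (abs_nonneg _)
    (by positivity)
  linarith [norm_tail_le hg x, norm_tail_le hg y]

end AbsolutelyContinuous

/-- The Cauchy–Schwarz inequality `(∫ f)² ≤ ∫ p ∫ q` if `f² ≤ p q`. -/
theorem sq_integral_le_mul_integral {α : Type*} [MeasurableSpace α] {m : Measure α} {f p q : α → ℝ}
    (hf : Integrable f m) (hp : Integrable p m) (hq : Integrable q m)
    (h : ∀ᵐ x ∂m, 0 ≤ p x ∧ 0 ≤ q x ∧ f x ^ 2 ≤ p x * q x) :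
    (∫ x, f x ∂m) ^ 2 ≤ (∫ x, p x ∂m) * ∫ x, q x ∂m := by
  -- The quadratic in `θ` is `∫ (p θ² - 2 f θ + q)`. Its integrand is nonnegative pointwise, so its
  -- discriminant is nonpositive.
  have key : ∀ θ : ℝ, 0 ≤ (∫ x, p x ∂m) * (θ * θ) + (-2 * ∫ x, f x ∂m) * θ + ∫ x, q x ∂m := by
    intro θ
    have h1 : 0 ≤ ∫ x, (p x * (θ * θ) + (-2 * f x) * θ + q x) ∂m := by
      refine integral_nonneg_of_ae ?_
      filter_upwards [h] with x ⟨hp0, hq0, hx⟩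
      rcases hp0.eq_or_lt with h0 | h0
      · have : f x = 0 := by
          rw [← h0, zero_mul] at hx
          exact pow_eq_zero_iff (two_ne_zero) |>.1 (le_antisymm hx (sq_nonneg _))
        simp [← h0, this, hq0]
      · refine nonneg_of_mul_nonneg_right (a := p x) ?_ h0
        nlinarith [sq_nonneg (p x * θ - f x)]
    have hp' : Integrable (fun x => p x * (θ * θ)) m := hp.mul_const _
    have hf' : Integrable (fun x => -2 * f x * θ) m := (hf.const_mul _).mul_const _
    have hpf : Integrable (fun x => p x * (θ * θ) + -2 * f x * θ) m := hp'.add hf'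
    rwa [integral_add hpf hq, integral_add hp' hf', integral_mul_const,
      integral_mul_const, integral_const_mul] at h1
  have := discrim_le_zero key
  rw [discrim] at this
  nlinarith

/-! ### The weight `ν` and the energy identity for `P`. -/

namespace IsMemoryKernel

variable {ℓ : EReal} {μ : ℝ → ℝ}

theorem nu_pos (hμ : IsMemoryKernel ℓ μ) {τ : ℝ} (hτ : τ ∈ memInterval ℓ) : 0 < nu μ τ :=
  one_div_pos.2 (hμ.pos τ hτ)

theorem mul_nu (hμ : IsMemoryKernel ℓ μ) {τ : ℝ} (hτ : τ ∈ memInterval ℓ) : μ τ * nu μ τ = 1 :=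
  mul_one_div_cancel (hμ.pos τ hτ).ne'

theorem monotoneOn_nu (hμ : IsMemoryKernel ℓ μ) : MonotoneOn (nu μ) (memInterval ℓ) :=
  fun _ ha _ hb hab => one_div_le_one_div_of_le (hμ.pos _ hb) (hμ.antitone ha hb hab)

theorem absolutelyContinuousOnInterval_nu (hμ : IsMemoryKernel ℓ μ) {a b : ℝ}
    (ha : a ∈ memInterval ℓ) (hb : b ∈ memInterval ℓ) (hab : a ≤ b) :
    AbsolutelyContinuousOnInterval (nu μ) a b :=
  absolutelyContinuousOnInterval_inv (hμ.absCont a ha b hb hab) fun x hx =>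
    hμ.pos x (Icc_subset_memInterval ha hb (by rwa [uIcc_of_le hab] at hx))

theorem deriv_nu_nonneg (hμ : IsMemoryKernel ℓ μ) {τ : ℝ} (hτ : τ ∈ memInterval ℓ) :
    0 ≤ deriv (nu μ) τ := by
  rw [← derivWithin_of_isOpen (isOpen_memInterval ℓ) hτ]
  exact hμ.monotoneOn_nu.derivWithin_nonneg

theorem exists_tendsto_nu (hμ : IsMemoryKernel ℓ μ) (hℓ : 0 < ℓ) :
    ∃ ν₀ : ℝ, 0 ≤ ν₀ ∧ Tendsto (nu μ) (𝓝[>] 0) (𝓝 ν₀) := by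
  obtain ⟨c, hc⟩ := (eventually_mem_nhdsGT hℓ).exists
  have hsub : Ioo 0 c ⊆ memInterval ℓ := fun x hx =>
    ⟨hx.1, lt_trans (by exact_mod_cast hx.2) hc.2⟩
  have h := (hμ.monotoneOn_nu.mono hsub).tendsto_nhdsWithin_Ioo_right (nonempty_Ioo.2 hc.1)
    ⟨0, by rintro _ ⟨x, hx, rfl⟩; exact (hμ.nu_pos (hsub hx)).le⟩
  refine ⟨_, ge_of_tendsto h ?_, h⟩
  filter_upwards [eventually_mem_nhdsGT hℓ] with τ hτ using (hμ.nu_pos hτ).le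

variable {X : Type*} [NormedAddCommGroup X] [InnerProductSpace ℝ X]

theorem integral_stateMeasure (hμ : IsMemoryKernel ℓ μ) {E : Type*} [NormedAddCommGroup E]
    [NormedSpace ℝ E] (f : ℝ → E) :
    ∫ τ, f τ ∂stateMeasure ℓ μ = ∫ τ in memInterval ℓ, nu μ τ • f τ := by
  rw [stateMeasure, integral_withDensity_eq_integral_toReal_smul₀ hμ.aemeasurable_density (by simp)]
  refine setIntegral_congr_fun (measurableSet_memInterval ℓ) fun τ hτ => ?_
  simp only [ENNReal.toReal_ofReal (hμ.nu_pos hτ).le]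

theorem integrable_stateMeasure_iff (hμ : IsMemoryKernel ℓ μ) {E : Type*} [NormedAddCommGroup E]
    [NormedSpace ℝ E] {f : ℝ → E} :
    Integrable f (stateMeasure ℓ μ) ↔ IntegrableOn (fun τ => nu μ τ • f τ) (memInterval ℓ) := by
  rw [stateMeasure, integrable_withDensity_iff_integrable_smul₀' hμ.aemeasurable_density (by simp)]
  refine integrable_congr ?_
  filter_upwards [ae_restrict_mem (measurableSet_memInterval ℓ)] with τ hτ
  simp only [ENNReal.toReal_ofReal (hμ.nu_pos hτ).le]

theorem inner_eq_integral (hμ : IsMemoryKernel ℓ μ) (ξ η : StateSpace ℓ μ X) :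
    ⟪ξ, η⟫_ℝ = ∫ τ in memInterval ℓ, nu μ τ * ⟪ξ τ, η τ⟫_ℝ := by
  rw [L2.inner_def, hμ.integral_stateMeasure]
  rfl

theorem integrableOn_inner (hμ : IsMemoryKernel ℓ μ) (ξ η : StateSpace ℓ μ X) :
    IntegrableOn (fun τ => nu μ τ * ⟪ξ τ, η τ⟫_ℝ) (memInterval ℓ) :=
  hμ.integrable_stateMeasure_iff.1 (L2.integrable_inner (𝕜 := ℝ) ξ η)

theorem integrableOn_norm_sq (hμ : IsMemoryKernel ℓ μ) (ξ : StateSpace ℓ μ X) :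
    IntegrableOn (fun τ => nu μ τ * ‖ξ τ‖ ^ 2) (memInterval ℓ) := by
  simpa only [real_inner_self_eq_norm_sq] using hμ.integrableOn_inner ξ ξ

theorem integrable_indicator_coe {Y : Type*} [NormedAddCommGroup Y] (hμ : IsMemoryKernel ℓ μ)
    (ξ : StateSpace ℓ μ Y) :
    Integrable ((memInterval ℓ).indicator ξ) :=
  (integrable_indicator_iff (measurableSet_memInterval ℓ)).2 (hμ.integrable_coe ξ)

/-- The energy density of the tail of `g` is small arbitrarily near the right end. -/
theorem frequently_energy_lt (hμ : IsMemoryKernel ℓ μ) (hℓ : 0 < ℓ) {g : StateSpace ℓ μ X}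
    (hF : IntegrableOn (fun τ => nu μ τ * ‖tail ((memInterval ℓ).indicator g) τ‖ ^ 2)
      (memInterval ℓ)) {ε : ℝ} (hε : 0 < ε) :
    ∃ᶠ τ in rightEnd ℓ, nu μ τ * ‖tail ((memInterval ℓ).indicator g) τ‖ ^ 2 < ε := by
  have hgi := hμ.integrable_indicator_coe g
  set G := tail ((memInterval ℓ).indicator g) with hG
  induction ℓ using EReal.rec with
  | bot => exact absurd hℓ (by simp)
  | top =>
    -- If `ν ‖G‖² ≥ ε` near infinity, the constant `ε` would be integrable on a half-line.
    intro hcon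
    simp only [not_lt] at hcon
    rw [rightEnd, eventually_comap] at hcon
    obtain ⟨l, hl, hlt⟩ := (mem_nhdsLT_iff_exists_Ioo_subset' hℓ).1 hcon
    obtain ⟨x, h1, -⟩ := EReal.lt_iff_exists_real_btwn.1 hl
    have hsub : Ioi (max x 0) ⊆ memInterval ⊤ := fun y hy =>
      ⟨(le_max_right _ _).trans_lt hy, EReal.coe_lt_top y⟩
    have hc : IntegrableOn (fun _ : ℝ => ε) (Ioi (max x 0)) := by
      refine (hF.mono_set hsub).mono' aestronglyMeasurable_const ?_
      filter_upwards [ae_restrict_mem measurableSet_Ioi] with y hy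
      rw [Real.norm_of_nonneg hε.le]
      refine hlt ⟨h1.trans ?_, EReal.coe_lt_top y⟩ y rfl
      exact_mod_cast (le_max_left _ _).trans_lt hy
    rw [integrableOn_const_iff] at hc
    simp [hε.ne'] at hc
  | coe r =>
    have := rightEnd_neBot hℓ
    set N := ∫ s in memInterval r, nu μ s * ‖g s‖ ^ 2
    have hN : 0 ≤ N := setIntegral_nonneg (measurableSet_memInterval _) fun s hs =>
      mul_nonneg (hμ.nu_pos hs).le (sq_nonneg _)
    -- By Cauchy–Schwarz with the weights `μ` and `ν`, `‖G(τ)‖² ≤ (∫_τ^r μ) N`. As `μ` is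
    -- nonincreasing, `∫_τ^r μ ≤ μ(τ) (r - τ)`, and the factor `μ(τ)` cancels `ν(τ)`.
    have hbound : ∀ τ ∈ memInterval (r : EReal), nu μ τ * ‖G τ‖ ^ 2 ≤ (r - τ) * N := by
      intro τ hτ
      have hτr : τ < r := by exact_mod_cast hτ.2
      have hset : memInterval (r : EReal) ∩ Ioi τ = Ioo τ r := by
        ext x
        constructor
        · rintro ⟨⟨h1, h2⟩, h3⟩
          exact ⟨h3, by exact_mod_cast h2⟩
        · rintro ⟨h1, h2⟩
          exact ⟨⟨hτ.1.trans h1, by exact_mod_cast h2⟩, h1⟩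
      have hsub : Ioo τ r ⊆ memInterval (r : EReal) := hset ▸ inter_subset_left
      have h1 : ‖G τ‖ ≤ ∫ s in Ioo τ r, ‖g s‖ := by
        rw [hG, tail, setIntegral_indicator (measurableSet_memInterval _), inter_comm, hset]
        exact norm_integral_le_integral_norm _
      have h2 : (∫ s in Ioo τ r, ‖g s‖) ^ 2 ≤
          (∫ s in Ioo τ r, μ s) * ∫ s in Ioo τ r, nu μ s * ‖g s‖ ^ 2 := by
        refine sq_integral_le_mul_integral ((hμ.integrable_coe g).mono_set hsub).norm
          (hμ.integrable.mono_set hsub) ((hμ.integrableOn_norm_sq g).mono_set hsub) ?_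
        filter_upwards [ae_restrict_mem measurableSet_Ioo] with s hs
        refine ⟨(hμ.pos s (hsub hs)).le, mul_nonneg (hμ.nu_pos (hsub hs)).le (sq_nonneg _), ?_⟩
        rw [← mul_assoc, hμ.mul_nu (hsub hs), one_mul]
      have h3 : ∫ s in Ioo τ r, μ s ≤ μ τ * (r - τ) := by
        have : ∫ s in Ioo τ r, μ s ≤ ∫ s in Ioo τ r, μ τ := by
          refine setIntegral_mono_on (hμ.integrable.mono_set hsub) ?_ measurableSet_Ioo
            fun s hs => hμ.antitone hτ (hsub hs) hs.1.le
          exact integrableOn_const (by simp)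
        refine this.trans_eq ?_
        simp [hτr.le, mul_comm]
      have h4 : ∫ s in Ioo τ r, nu μ s * ‖g s‖ ^ 2 ≤ N := by
        refine setIntegral_mono_set (hμ.integrableOn_norm_sq g) ?_ hsub.eventuallyLE
        filter_upwards [ae_restrict_mem (measurableSet_memInterval _)] with s hs
        exact mul_nonneg (hμ.nu_pos hs).le (sq_nonneg _)
      have h5 : ‖G τ‖ ^ 2 ≤ μ τ * (r - τ) * N := by
        calc ‖G τ‖ ^ 2 ≤ (∫ s in Ioo τ r, ‖g s‖) ^ 2 := by gcongr
          _ ≤ _ := h2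
          _ ≤ _ := by
            refine mul_le_mul h3 h4 ?_ (mul_nonneg (hμ.pos τ hτ).le (by linarith))
            exact setIntegral_nonneg measurableSet_Ioo fun s hs =>
              mul_nonneg (hμ.nu_pos (hsub hs)).le (sq_nonneg _)
      calc nu μ τ * ‖G τ‖ ^ 2 ≤ nu μ τ * (μ τ * (r - τ) * N) := by
            gcongr; exact (hμ.nu_pos hτ).le
        _ = μ τ * nu μ τ * ((r - τ) * N) := by ring
        _ = _ := by rw [hμ.mul_nu hτ, one_mul]
    refine Eventually.frequently ?_
    -- Dividing by `N + 1` instead of `N` covers the case `N = 0`.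
    have hlt : r - ε / (N + 1) < r := by
      have : 0 < ε / (N + 1) := by positivity
      linarith
    filter_upwards [eventually_mem_rightEnd hℓ,
      eventually_lt_rightEnd (s := r - ε / (N + 1)) (by exact_mod_cast hlt)] with τ h1 h2
    refine (hbound τ h1).trans_lt ?_
    have hτr : τ < r := by exact_mod_cast h1.2
    calc (r - τ) * N ≤ (r - τ) * (N + 1) := by gcongr; linarith
      _ < ε / (N + 1) * (N + 1) := by gcongr; linarith
      _ = ε := by field_simp

/-- Zero is a cluster value of a nonnegative function along a countably generated filter, so it is a
limit along a sequence. A sequence is enough for the energy identity, where only an exhaustion of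
`Ω` by intervals is needed. -/
theorem exists_seq_energy_tendsto_zero (hμ : IsMemoryKernel ℓ μ) (hℓ : 0 < ℓ)
    {g : StateSpace ℓ μ X}
    (hF : IntegrableOn (fun τ => nu μ τ * ‖tail ((memInterval ℓ).indicator g) τ‖ ^ 2)
      (memInterval ℓ)) :
    ∃ b : ℕ → ℝ, Tendsto b atTop (rightEnd ℓ) ∧ Tendsto (fun n => nu μ (b n) *
      ‖tail ((memInterval ℓ).indicator g) (b n)‖ ^ 2) atTop (𝓝 0) := by
  set F := fun τ => nu μ τ * ‖tail ((memInterval ℓ).indicator g) τ‖ ^ 2 with hFdef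
  have hcl : MapClusterPt 0 (rightEnd ℓ) F := by
    refine mapClusterPt_iff_frequently.2 fun s hs => ?_
    obtain ⟨ε, hε, hsub⟩ := Metric.mem_nhds_iff.1 hs
    refine ((hμ.frequently_energy_lt hℓ hF hε).and_eventually (eventually_mem_rightEnd hℓ)).mono ?_
    rintro τ ⟨h1, h2⟩
    refine hsub ?_
    have : 0 ≤ F τ := mul_nonneg (hμ.nu_pos h2).le (sq_nonneg _)
    rw [Metric.mem_ball, Real.dist_eq, sub_zero, abs_of_nonneg this]
    exact h1
  have hne : (rightEnd ℓ ⊓ comap F (𝓝 0)).NeBot := by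
    rw [MapClusterPt, ClusterPt, inf_comm] at hcl
    rwa [neBot_inf_comap_iff_map]
  obtain ⟨b, hb⟩ := exists_seq_tendsto (rightEnd ℓ ⊓ comap F (𝓝 0))
  rw [tendsto_inf, tendsto_comap_iff] at hb
  exact ⟨b, hb.1, hb.2⟩

theorem aecover_Icc {a b : ℕ → ℝ} (ha : Tendsto a atTop (𝓝[>] 0))
    (hb : Tendsto b atTop (rightEnd ℓ)) :
    AECover (volume.restrict (memInterval ℓ)) atTop fun n => Icc (a n) (b n) where
  ae_eventually_mem := by
    filter_upwards [ae_restrict_mem (measurableSet_memInterval ℓ)] with x hx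
    filter_upwards [ha.eventually (nhdsWithin_le_nhds (Iio_mem_nhds hx.1)),
      hb.eventually (eventually_lt_rightEnd hx.2)] with n h1 h2 using ⟨h1.le, h2.le⟩
  measurableSet _ := measurableSet_Icc


variable [CompleteSpace X]

theorem deriv_norm_sq_tail_ae {g : ℝ → X} (hg : Integrable g) :
    ∀ᵐ τ, deriv (fun τ => ‖tail g τ‖ ^ 2) τ = -(2 * ⟪tail g τ, g τ⟫_ℝ) := by
  filter_upwards [ae_hasDerivAt_tail hg] with τ hτ
  rw [hτ.norm_sq.deriv, inner_neg_right, mul_neg]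

/-- The energy identity for the operator `P`. -/
theorem energy_identity (hμ : IsMemoryKernel ℓ μ) (hℓ : 0 < ℓ) {ν₀ : ℝ}
    (hν : Tendsto (nu μ) (𝓝[>] 0) (𝓝 ν₀)) {ξ g : StateSpace ℓ μ X} (hd : IsDistribDeriv ℓ ξ g)
    (hv : VanishesAtEnd ℓ ξ) :
    ∃ f : ℝ → X, IsContRep ℓ f ξ ∧ ∃ x₀ : X, Tendsto f (𝓝[>] 0) (𝓝 x₀) ∧
      IntegrableOn (fun τ => deriv (nu μ) τ * ‖f τ‖ ^ 2) (memInterval ℓ) ∧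
      2 * ⟪ξ, g⟫_ℝ =
        -(ν₀ * ‖x₀‖ ^ 2) - ∫ τ in memInterval ℓ, deriv (nu μ) τ * ‖f τ‖ ^ 2 := by
  have hgi := hμ.integrable_indicator_coe g
  have hξG := ae_eq_neg_tail hℓ (hμ.integrable_coe ξ) (hμ.integrable_coe g) hd hv
  have hFi : IntegrableOn (fun τ => nu μ τ * ‖tail ((memInterval ℓ).indicator g) τ‖ ^ 2)
      (memInterval ℓ) := by
    refine (hμ.integrableOn_norm_sq ξ).congr ?_
    filter_upwards [hξG] with τ hτ
    rw [hτ, norm_neg]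
  obtain ⟨b, hb, hFb⟩ := hμ.exists_seq_energy_tendsto_zero hℓ hFi
  obtain ⟨a, ha⟩ := exists_seq_tendsto (𝓝[>] (0 : ℝ))
  set G := tail ((memInterval ℓ).indicator g) with hG
  have hGc : Continuous G := continuous_tail hgi
  have hG0 : Tendsto G (𝓝[>] 0) (𝓝 (G 0)) := hGc.continuousAt.tendsto.mono_left nhdsWithin_le_nhds
  have hcover := aecover_Icc ha hb
  have hI : IntegrableOn (fun τ => nu μ τ * ⟪ξ τ, g τ⟫_ℝ) (memInterval ℓ) :=
    hμ.integrableOn_inner ξ g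
  obtain ⟨c, hc⟩ := (eventually_mem_nhdsGT hℓ).exists
  have hev : ∀ᶠ n in atTop, a n ∈ memInterval ℓ ∧ b n ∈ memInterval ℓ ∧ a n ≤ b n := by
    filter_upwards [ha.eventually (eventually_mem_nhdsGT hℓ),
      hb.eventually (eventually_mem_rightEnd hℓ),
      ha.eventually (nhdsWithin_le_nhds (Iio_mem_nhds hc.1)),
      hb.eventually (eventually_lt_rightEnd hc.2)] with n h1 h2 h3 h4 using
        ⟨h1, h2, (h3.trans h4).le⟩
  have hii : ∀ {p q : ℝ}, p ∈ memInterval ℓ → q ∈ memInterval ℓ → p ≤ q →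
      IntegrableOn (fun τ => deriv (nu μ) τ * ‖G τ‖ ^ 2) (Icc p q) := by
    intro p q hp hq hpq
    have := (hμ.absolutelyContinuousOnInterval_nu hp hq hpq).intervalIntegrable_deriv.mul_continuousOn
      (g := fun τ => ‖G τ‖ ^ 2) (hGc.norm.pow 2).continuousOn
    rwa [intervalIntegrable_iff_integrableOn_Icc_of_le hpq] at this
  -- Integration by parts for the absolutely continuous functions `ν` and `‖G‖²`, using `(‖G‖²)' =
  -- -2 ⟪G, g⟫ = 2 ⟪ξ, g⟫` almost everywhere, since `ξ = -G`.
  have hid : ∀ {p q : ℝ}, p ∈ memInterval ℓ → q ∈ memInterval ℓ → p ≤ q →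
      ∫ τ in Icc p q, deriv (nu μ) τ * ‖G τ‖ ^ 2 = nu μ q * ‖G q‖ ^ 2 - nu μ p * ‖G p‖ ^ 2 -
        2 * ∫ τ in Icc p q, nu μ τ * ⟪ξ τ, g τ⟫_ℝ := by
    intro p q hp hq hpq
    have hsub := Icc_subset_memInterval hp hq
    have h1 := (hμ.absolutelyContinuousOnInterval_nu hp hq hpq).integral_deriv_mul_eq_sub
      (absolutelyContinuousOnInterval_norm_sq_tail hgi p q)
    rw [← hG, intervalIntegral.integral_of_le hpq, ← integral_Icc_eq_integral_Ioc] at h1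
    rw [← h1, eq_sub_iff_add_eq, ← integral_const_mul,
      ← integral_add (hii hp hq hpq) ((hI.mono_set hsub).const_mul 2)]
    refine setIntegral_congr_ae measurableSet_Icc ?_
    filter_upwards [deriv_norm_sq_tail_ae hgi,
      (ae_restrict_iff' (measurableSet_memInterval ℓ)).1 hξG] with τ h2 h3 h4
    rw [← hG] at h2
    rw [h2, h3 (hsub h4), inner_neg_left, indicator_of_mem (hsub h4)]
    ring
  -- The boundary term at `b n` vanishes by the choice of `b`, the one at `a n` tends to `ν₀ ‖G
  -- 0‖²`, and `ν ⟪ξ, g⟫` is integrable on `Ω`. As `ν' ‖G‖²` is nonnegative, convergence of its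
  -- integrals over the exhaustion also yields its summability.
  have hlim : Tendsto (fun n => ∫ τ in Icc (a n) (b n), deriv (nu μ) τ * ‖G τ‖ ^ 2
      ∂volume.restrict (memInterval ℓ)) atTop (𝓝 (0 - ν₀ * ‖G 0‖ ^ 2 - 2 * ⟪ξ, g⟫_ℝ)) := by
    have h1 := hcover.integral_tendsto_of_countably_generated hI
    rw [← hμ.inner_eq_integral] at h1
    have h2 := (hν.mul (hG0.norm.pow 2)).comp ha
    refine ((hFb.sub h2).sub (h1.const_mul 2)).congr' ?_
    filter_upwards [hev] with n ⟨h3, h4, h5⟩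
    have hsub := Icc_subset_memInterval h3 h4
    rw [Measure.restrict_restrict measurableSet_Icc, inter_eq_self_of_subset_left hsub,
      hid h3 h4 h5]
    rfl
  have hnn : ∀ᵐ τ ∂volume.restrict (memInterval ℓ), 0 ≤ deriv (nu μ) τ * ‖G τ‖ ^ 2 := by
    filter_upwards [ae_restrict_mem (measurableSet_memInterval ℓ)] with τ hτ
    exact mul_nonneg (hμ.deriv_nu_nonneg hτ) (sq_nonneg _)
  obtain ⟨N, hN⟩ := eventually_atTop.1 hev
  -- The sequences are shifted by `N` so that every interval, not only those of large index, is a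
  -- nonempty compact interval inside `Ω`.
  have hcover' := aecover_Icc ((tendsto_add_atTop_iff_nat N).2 ha) ((tendsto_add_atTop_iff_nat N).2 hb)
  have hfi : ∀ n, IntegrableOn (fun τ => deriv (nu μ) τ * ‖G τ‖ ^ 2) (Icc (a (n + N)) (b (n + N)))
      (volume.restrict (memInterval ℓ)) := fun n => by
    obtain ⟨h3, h4, h5⟩ := hN (n + N) (Nat.le_add_left _ _)
    exact (hii h3 h4 h5).mono_measure Measure.restrict_le_self
  have hlim' := (tendsto_add_atTop_iff_nat N).2 hlim
  -- The representative `-G` is continuous on the whole line, so its limit at `0` exists even when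
  -- `ν₀ = 0`.
  refine ⟨fun τ => -G τ, ⟨hGc.neg.continuousOn, hξG.symm⟩, -G 0, hG0.neg, ?_, ?_⟩
  · simp only [norm_neg]
    exact hcover'.integrable_of_integral_tendsto_of_nonneg_ae _ hfi hnn hlim'
  · simp only [norm_neg]
    rw [hcover'.integral_eq_of_tendsto_of_nonneg_ae _ hnn hfi hlim']
    ring

end IsMemoryKernel

/-! ### Maximal dissipative operators: bounded exponentials, resolvents and Yosida approximations.
-/

section HilleYosida

variable {E : Type*} [NormedAddCommGroup E] [InnerProductSpace ℝ E]

/-- A linear operator `T` is maximal dissipative if `⟪T x, x⟫ ≤ 0` on its domain and `c - T` is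
onto for all `c > 0`. -/
structure IsMaximalDissipative (T : E →ₗ.[ℝ] E) : Prop where
  dissipative : ∀ x : T.domain, ⟪T x, (x : E)⟫_ℝ ≤ 0
  surjective : ∀ c : ℝ, 0 < c → ∀ y : E, ∃ x : T.domain, c • (x : E) - T x = y

/-- `exp (t B)` for a bounded operator `B`. -/
noncomputable def expOp (B : E →L[ℝ] E) (t : ℝ) : E →L[ℝ] E := NormedSpace.exp (t • B)

section Bounded

variable (B C : E →L[ℝ] E)

theorem expOp_zero : expOp B 0 = 1 := by simp [expOp]

theorem expOp_commute {B C : E →L[ℝ] E} (h : Commute B C) (t : ℝ) : Commute (expOp B t) C :=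
  (h.smul_left t).exp_left

variable [CompleteSpace E]

theorem expOp_add (s t : ℝ) : expOp B (s + t) = expOp B s * expOp B t := by
  let _ : NormedAlgebra ℚ (E →L[ℝ] E) := NormedAlgebra.restrictScalars ℚ ℝ _
  rw [expOp, add_smul, NormedSpace.exp_add_of_commute]
  · rfl
  · exact ((Commute.refl B).smul_left s).smul_right t

theorem hasDerivAt_expOp (t : ℝ) : HasDerivAt (expOp B) (expOp B t * B) t :=
  hasDerivAt_exp_smul_const B t

theorem hasDerivAt_expOp_apply (x : E) (t : ℝ) :
    HasDerivAt (fun t => expOp B t x) (expOp B t (B x)) t :=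
  ((ContinuousLinearMap.apply ℝ E x).hasFDerivAt.comp_hasDerivAt t (hasDerivAt_expOp B t))

theorem continuous_expOp_apply (x : E) : Continuous fun t => expOp B t x :=
  continuous_iff_continuousAt.2 fun t => (hasDerivAt_expOp_apply B x t).continuousAt

variable {B C}

/-- The derivative of `‖exp (s B) x‖²` is `2 ⟪B y, y⟫ ≤ 0` with `y = exp (s B) x`. -/
theorem norm_expOp_apply_le (hB : ∀ x, ⟪B x, x⟫_ℝ ≤ 0) {t : ℝ} (ht : 0 ≤ t) (x : E) :
    ‖expOp B t x‖ ≤ ‖x‖ := by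
  have hd : ∀ s, HasDerivAt (fun s => ‖expOp B s x‖ ^ 2) (2 * ⟪expOp B s x, B (expOp B s x)⟫_ℝ) s := by
    intro s
    have h := (hasDerivAt_expOp_apply B x s).norm_sq
    have hc : expOp B s (B x) = B (expOp B s x) :=
      DFunLike.congr_fun (expOp_commute (Commute.refl B) s).eq x
    rwa [hc] at h
  have hanti : Antitone fun s => ‖expOp B s x‖ ^ 2 :=
    antitone_of_hasDerivAt_nonpos hd fun s => by
      have := hB (expOp B s x)
      rw [real_inner_comm] at this
      exact mul_nonpos_of_nonneg_of_nonpos zero_le_two this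
  have h1 := hanti ht
  simp only [expOp_zero, one_apply_eq_self] at h1
  exact le_of_sq_le_sq h1 (norm_nonneg _)

/-- The path `s ↦ exp (s B) exp ((t - s) C) x` joins the two vectors. By commutation its velocity is
a product of two contractions applied to `B x - C x`. -/
theorem norm_expOp_sub_le (hB : ∀ x, ⟪B x, x⟫_ℝ ≤ 0) (hC : ∀ x, ⟪C x, x⟫_ℝ ≤ 0)
    (h : Commute B C) {t : ℝ} (ht : 0 ≤ t) (x : E) :
    ‖expOp B t x - expOp C t x‖ ≤ t * ‖B x - C x‖ := by
  have hd : ∀ s, HasDerivAt (fun s => (expOp B s * expOp C (t - s)) x)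
      ((expOp B s * expOp C (t - s)) (B x - C x)) s := by
    intro s
    have h2 : HasDerivAt (fun s => expOp C (t - s)) (-(expOp C (t - s) * C)) s := by
      have := (hasDerivAt_expOp C (t - s)).scomp s ((hasDerivAt_id s).const_sub t)
      rwa [neg_one_smul] at this
    have h3 := (hasDerivAt_expOp B s).mul h2
    have h4 := (ContinuousLinearMap.apply ℝ E x).hasFDerivAt.comp_hasDerivAt s h3
    have hc : B (expOp C (t - s) x) = expOp C (t - s) (B x) :=
      (DFunLike.congr_fun (expOp_commute h.symm (t - s)).eq x).symm
    have h5 : (ContinuousLinearMap.apply ℝ E x) (expOp B s * B * expOp C (t - s) +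
        expOp B s * -(expOp C (t - s) * C)) = (expOp B s * expOp C (t - s)) (B x - C x) := by
      change expOp B s (B (expOp C (t - s) x)) + expOp B s (-(expOp C (t - s) (C x))) =
        expOp B s (expOp C (t - s) (B x - C x))
      rw [hc, map_neg, map_sub, map_sub, ← sub_eq_add_neg]
    rwa [h5] at h4
  have hb := norm_image_sub_le_of_norm_deriv_le_segment' (a := 0) (b := t) (C := ‖B x - C x‖)
    (fun s _ => (hd s).hasDerivWithinAt) (fun s hs => (norm_expOp_apply_le hB hs.1 _).trans
      (norm_expOp_apply_le hC (sub_nonneg.2 hs.2.le) _)) t ⟨ht, le_rfl⟩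
  simpa [expOp_zero, mul_comm] using hb

end Bounded

/-- Contractions which form a Cauchy sequence on a dense set converge strongly to a contraction. -/
theorem exists_strong_limit [CompleteSpace E] {U : ℕ → E →L[ℝ] E} (hU : ∀ n x, ‖U n x‖ ≤ ‖x‖)
    {D : Set E} (hD : Dense D) (hc : ∀ x ∈ D, CauchySeq fun n => U n x) :
    ∃ S : E →L[ℝ] E, (∀ x, ‖S x‖ ≤ ‖x‖) ∧ ∀ x, Tendsto (fun n => U n x) atTop (𝓝 (S x)) := by
  have hall : ∀ x, CauchySeq fun n => U n x := by
    intro x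
    refine Metric.cauchySeq_iff'.2 fun ε hε => ?_
    obtain ⟨y, hy, hxy⟩ := Metric.dense_iff.1 hD x (ε / 3) (by positivity)
    obtain ⟨N, hN⟩ := Metric.cauchySeq_iff'.1 (hc y hxy) (ε / 3) (by positivity)
    refine ⟨N, fun n hn => ?_⟩
    have hyx : ‖x - y‖ < ε / 3 := by
      rw [← dist_eq_norm, dist_comm]; exact hy
    -- Uniform contractivity makes the error of replacing `x` by a nearby `y ∈ D` independent of the
    -- index.
    have h1 : ∀ k, dist (U k x) (U k y) < ε / 3 := fun k => by
      rw [dist_eq_norm, ← map_sub]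
      exact (hU k _).trans_lt hyx
    calc dist (U n x) (U N x) ≤ dist (U n x) (U n y) + dist (U n y) (U N y) +
          dist (U N y) (U N x) := dist_triangle4 _ _ _ _
      _ < ε / 3 + ε / 3 + ε / 3 := by
          rw [dist_comm (U N y)]
          exact add_lt_add (add_lt_add (h1 n) (hN n hn)) (h1 N)
      _ = ε := by ring
  choose f hf using fun x => cauchySeq_tendsto_of_complete (hall x)
  refine ⟨continuousLinearMapOfTendsto U (tendsto_pi_nhds.2 hf), fun x => ?_, hf⟩
  exact le_of_tendsto (hf x).norm (Eventually.of_forall fun n => hU n x)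

namespace IsMaximalDissipative

variable {T : E →ₗ.[ℝ] E}

/-- Pairing `c x - T x` with `x` and using dissipativity gives `c ‖x‖² ≤ ‖c x - T x‖ ‖x‖`.
Injectivity of `c - T` and the resolvent bound follow. -/
theorem mul_norm_le (hT : IsMaximalDissipative T) (c : ℝ) (x : T.domain) :
    c * ‖(x : E)‖ ≤ ‖c • (x : E) - T x‖ := by
  rcases (norm_nonneg (x : E)).eq_or_lt with h0 | h0
  · rw [← h0, mul_zero]; exact norm_nonneg _
  · refine le_of_mul_le_mul_right ?_ h0
    have h1 := real_inner_le_norm (c • (x : E) - T x) x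
    rw [inner_sub_left, real_inner_smul_left, real_inner_self_eq_norm_sq] at h1
    nlinarith [hT.dissipative x]

theorem exists_resolvent (hT : IsMaximalDissipative T) {c : ℝ} (hc : 0 < c) :
    ∃ R : E →L[ℝ] E, (∀ y, ∃ h : R y ∈ T.domain, c • R y - T ⟨R y, h⟩ = y) ∧
      (∀ y, c * ‖R y‖ ≤ ‖y‖) ∧ ∀ x : T.domain, R (c • (x : E) - T x) = x := by
  let M : T.domain →ₗ[ℝ] E := c • T.domain.subtype - T.toFun
  have hM : ∀ x, M x = c • (x : E) - T x := fun x => rfl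
  have hinj : Function.Injective M := by
    rw [injective_iff_map_eq_zero]
    intro x hx
    have h1 := hT.mul_norm_le c x
    rw [← hM, hx, norm_zero] at h1
    have : ‖(x : E)‖ ≤ 0 := nonpos_of_mul_nonpos_right h1 hc
    exact Subtype.ext (norm_le_zero_iff.1 this)
  let e := LinearEquiv.ofBijective M ⟨hinj, hT.surjective c hc⟩
  have he : ∀ y, M (e.symm y) = y := fun y => e.apply_symm_apply y
  have hb : ∀ y, c * ‖((e.symm y : T.domain) : E)‖ ≤ ‖y‖ := fun y => by
    have := hT.mul_norm_le c (e.symm y)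
    rwa [← hM, he] at this
  refine ⟨(T.domain.subtype ∘ₗ e.symm.toLinearMap).mkContinuous c⁻¹ fun y => ?_,
    fun y => ⟨(e.symm y).2, he y⟩, hb, fun x => ?_⟩
  · rw [← div_eq_inv_mul, le_div_iff₀ hc, mul_comm]
    exact hb y
  · exact congrArg Subtype.val (e.symm_apply_apply x)

/-- If `y` is orthogonal to the domain and `y = x - T x`, then `0 = ⟪x, y⟫ ≥ ‖x‖²`, so `x = 0` and
`y = 0`. -/
theorem dense_domain [CompleteSpace E] (hT : IsMaximalDissipative T) : Dense (T.domain : Set E) := by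
  rw [Submodule.dense_iff_topologicalClosure_eq_top, Submodule.topologicalClosure_eq_top_iff,
    Submodule.eq_bot_iff]
  intro y hy
  obtain ⟨x, hx⟩ := hT.surjective 1 one_pos y
  have h1 : ⟪(x : E), y⟫_ℝ = 0 := Submodule.inner_right_of_mem_orthogonal x.2 hy
  rw [← hx, one_smul, inner_sub_right, real_inner_self_eq_norm_sq, real_inner_comm] at h1
  have h2 := hT.dissipative x
  have h3 : ‖(x : E)‖ ^ 2 = 0 := le_antisymm (by linarith) (sq_nonneg _)
  have h4 : x = 0 := Subtype.ext (by simpa using h3)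
  rw [← hx, h4]
  simp

/-- The resolvent `(c - T)⁻¹`, for `c > 0`. -/
noncomputable def resolvent (hT : IsMaximalDissipative T) (c : {c : ℝ // 0 < c}) : E →L[ℝ] E :=
  Classical.choose (hT.exists_resolvent c.2)

variable (hT : IsMaximalDissipative T) (c d : {c : ℝ // 0 < c})

theorem resolvent_mem (y : E) : hT.resolvent c y ∈ T.domain :=
  ((Classical.choose_spec (hT.exists_resolvent c.2)).1 y).1

theorem smul_resolvent_sub (y : E) :
    (c : ℝ) • hT.resolvent c y - T ⟨hT.resolvent c y, hT.resolvent_mem c y⟩ = y :=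
  ((Classical.choose_spec (hT.exists_resolvent c.2)).1 y).2

theorem mul_norm_resolvent_le (y : E) : (c : ℝ) * ‖hT.resolvent c y‖ ≤ ‖y‖ :=
  (Classical.choose_spec (hT.exists_resolvent c.2)).2.1 y

theorem resolvent_apply (x : T.domain) : hT.resolvent c ((c : ℝ) • (x : E) - T x) = x :=
  (Classical.choose_spec (hT.exists_resolvent c.2)).2.2 x

theorem smul_resolvent_eq (x : T.domain) :
    (c : ℝ) • hT.resolvent c x = x + hT.resolvent c (T x) := by
  have := hT.resolvent_apply c x
  rw [map_sub, map_smul] at this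
  rw [← sub_eq_iff_eq_add, this]

theorem resolvent_sub_resolvent (y : E) : hT.resolvent c y - hT.resolvent d y =
    ((d : ℝ) - c) • hT.resolvent c (hT.resolvent d y) := by
  have h1 := hT.resolvent_apply c ⟨hT.resolvent d y, hT.resolvent_mem d y⟩
  have h2 := hT.smul_resolvent_sub d y
  have h3 : y - ((c : ℝ) • hT.resolvent d y - T ⟨hT.resolvent d y, hT.resolvent_mem d y⟩) =
      ((d : ℝ) - c) • hT.resolvent d y := by
    nth_rewrite 1 [← h2]
    module
  rw [← map_smul, ← h3, map_sub, h1]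

/-- For `c ≠ d`, exchanging the parameters in the resolvent identity only changes signs, and the
factor `d - c` can be cancelled. -/
theorem resolvent_commute : Commute (hT.resolvent c) (hT.resolvent d) := by
  by_cases h : (d : ℝ) = c
  · rw [Subtype.ext h]
  · ext y
    have h1 := hT.resolvent_sub_resolvent c d y
    have h2 := hT.resolvent_sub_resolvent d c y
    have h3 : ((d : ℝ) - c) • hT.resolvent c (hT.resolvent d y) =
        ((d : ℝ) - c) • hT.resolvent d (hT.resolvent c y) := by
      rw [← h1, ← neg_sub (c : ℝ) d, neg_smul, ← h2, neg_sub]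
    exact smul_right_injective E (sub_ne_zero.2 h) h3

/-- The Yosida approximation `c² (c - T)⁻¹ - c` of `T`. -/
noncomputable def yosida : E →L[ℝ] E := ((c : ℝ) ^ 2) • hT.resolvent c - (c : ℝ) • 1

theorem yosida_commute : Commute (hT.yosida c) (hT.yosida d) := by
  have h := hT.resolvent_commute c d
  refine Commute.sub_left (Commute.sub_right ?_ ?_) (Commute.sub_right ?_ ?_)
  · exact (h.smul_left _).smul_right _
  · exact (Commute.one_right _).smul_right _
  · exact (Commute.one_left _).smul_left _
  · exact (Commute.one_right _).smul_right _

/-- On the domain the Yosida approximation is `c (c - T)⁻¹ T`, where `c (c - T)⁻¹` is a contraction.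
Hence it is dominated by `T`. -/
theorem yosida_apply (x : T.domain) : hT.yosida c x = (c : ℝ) • hT.resolvent c (T x) := by
  have h : hT.yosida c x = (c : ℝ) • ((c : ℝ) • hT.resolvent c x) - (c : ℝ) • (x : E) := by
    simp [yosida, smul_smul, sq]
  rw [h, hT.smul_resolvent_eq, smul_add, add_sub_cancel_left]

theorem norm_yosida_apply_le (x : T.domain) : ‖hT.yosida c x‖ ≤ ‖T x‖ := by
  rw [hT.yosida_apply, norm_smul, Real.norm_of_nonneg c.2.le]
  exact hT.mul_norm_resolvent_le c _

theorem inner_yosida_nonpos (x : E) : ⟪hT.yosida c x, x⟫_ℝ ≤ 0 := by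
  have h : ⟪hT.yosida c x, x⟫_ℝ =
      (c : ℝ) * ((c : ℝ) * ⟪hT.resolvent c x, x⟫_ℝ - ‖x‖ ^ 2) := by
    simp [yosida, inner_sub_left, real_inner_smul_left]; ring
  rw [h]
  refine mul_nonpos_of_nonneg_of_nonpos c.2.le ?_
  have h1 := mul_le_mul_of_nonneg_left (real_inner_le_norm (hT.resolvent c x) x) c.2.le
  nlinarith [mul_le_mul_of_nonneg_right (hT.mul_norm_resolvent_le c x) (norm_nonneg x)]

/-- The sequence `1, 2, 3, …` of parameters of the Yosida approximations. -/
def param (n : ℕ) : {c : ℝ // 0 < c} := ⟨n + 1, n.cast_add_one_pos⟩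

/-- On the domain, `c R x - x = R (T x)` has norm at most `‖T x‖ / c`. Density and contractivity of
`c R` give all `x`. -/
theorem tendsto_param_smul_resolvent [CompleteSpace E] (x : E) :
    Tendsto (fun n => (param n : ℝ) • hT.resolvent (param n) x) atTop (𝓝 x) := by
  have hdom : ∀ x ∈ T.domain,
      Tendsto (fun n => (param n : ℝ) • hT.resolvent (param n) x) atTop (𝓝 x) := by
    intro x hx
    rw [tendsto_iff_norm_sub_tendsto_zero]
    refine squeeze_zero (fun _ => norm_nonneg _) (g := fun n : ℕ => ‖T ⟨x, hx⟩‖ / ((n : ℝ) + 1))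
      (fun n => ?_) ?_
    · have h1 := hT.smul_resolvent_eq (param n) ⟨x, hx⟩
      rw [h1, add_sub_cancel_left, le_div_iff₀ n.cast_add_one_pos, mul_comm]
      exact hT.mul_norm_resolvent_le (param n) _
    · exact tendsto_const_nhds.div_atTop
        (tendsto_atTop_add_const_right _ _ tendsto_natCast_atTop_atTop)
  obtain ⟨S, -, hS⟩ := exists_strong_limit
    (U := fun n => (param n : ℝ) • hT.resolvent (param n)) (fun n x => by
      rw [smul_apply, norm_smul, Real.norm_of_nonneg (param n).2.le]
      exact hT.mul_norm_resolvent_le _ _) hT.dense_domain fun x hx => (hdom x hx).cauchySeq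
  have : (S : E → E) = id := by
    refine Continuous.ext_on hT.dense_domain S.continuous continuous_id fun x hx => ?_
    exact tendsto_nhds_unique (hS x) (hdom x hx)
  have h2 := hS x
  rwa [this] at h2

theorem tendsto_yosida [CompleteSpace E] (x : T.domain) :
    Tendsto (fun n => hT.yosida (param n) x) atTop (𝓝 (T x)) := by
  simp_rw [hT.yosida_apply]
  exact hT.tendsto_param_smul_resolvent (T x)

end IsMaximalDissipative

end HilleYosida

/-! ### The generated semigroup, its generator, and mild solutions. -/

section Semigroup

variable {E : Type*} [NormedAddCommGroup E] [InnerProductSpace ℝ E]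

namespace IsMaximalDissipative

variable [CompleteSpace E] {T : E →ₗ.[ℝ] E} (hT : IsMaximalDissipative T)

theorem norm_expOp_yosida_le (n : ℕ) {t : ℝ} (ht : 0 ≤ t) (x : E) :
    ‖expOp (hT.yosida (param n)) t x‖ ≤ ‖x‖ :=
  norm_expOp_apply_le (hT.inner_yosida_nonpos _) ht x

theorem exists_expOp_limit (t : ℝ≥0) : ∃ S : E →L[ℝ] E, (∀ x, ‖S x‖ ≤ ‖x‖) ∧
    ∀ x, Tendsto (fun n => expOp (hT.yosida (param n)) t x) atTop (𝓝 (S x)) := by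
  refine exists_strong_limit (fun n x => hT.norm_expOp_yosida_le n t.2 x) hT.dense_domain
    fun x hx => ?_
  refine Metric.cauchySeq_iff'.2 fun ε hε => ?_
  obtain ⟨N, hN⟩ := Metric.cauchySeq_iff'.1 (hT.tendsto_yosida ⟨x, hx⟩).cauchySeq
    (ε / (t + 1)) (by positivity)
  refine ⟨N, fun n hn => ?_⟩
  have h1 := hN n hn
  rw [dist_eq_norm] at h1 ⊢
  refine (norm_expOp_sub_le (hT.inner_yosida_nonpos _) (hT.inner_yosida_nonpos _)
    (hT.yosida_commute _ _) t.2 x).trans_lt ?_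
  rw [lt_div_iff₀ (by positivity), mul_comm] at h1
  refine lt_of_le_of_lt ?_ h1
  exact mul_le_mul_of_nonneg_right (by simp) (norm_nonneg _)

/-- The semigroup generated by a maximal dissipative operator. -/
noncomputable def semigroup (t : ℝ≥0) : E →L[ℝ] E := Classical.choose (hT.exists_expOp_limit t)

theorem norm_semigroup_apply_le (t : ℝ≥0) (x : E) : ‖hT.semigroup t x‖ ≤ ‖x‖ :=
  (Classical.choose_spec (hT.exists_expOp_limit t)).1 x

theorem tendsto_semigroup (t : ℝ≥0) (x : E) :
    Tendsto (fun n => expOp (hT.yosida (param n)) t x) atTop (𝓝 (hT.semigroup t x)) :=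
  (Classical.choose_spec (hT.exists_expOp_limit t)).2 x

/-- Strong convergence of the approximating semigroups along a convergent sequence. -/
theorem tendsto_semigroup_seq (t : ℝ≥0) {u : ℕ → E} {x : E} (hu : Tendsto u atTop (𝓝 x)) :
    Tendsto (fun n => expOp (hT.yosida (param n)) t (u n)) atTop (𝓝 (hT.semigroup t x)) := by
  have h1 : Tendsto (fun n => expOp (hT.yosida (param n)) t (u n - x)) atTop (𝓝 0) := by
    refine squeeze_zero_norm (fun n => hT.norm_expOp_yosida_le n t.2 _) ?_
    exact tendsto_iff_norm_sub_tendsto_zero.1 hu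
  have h2 := h1.add (hT.tendsto_semigroup t x)
  simpa using h2

theorem semigroup_zero : hT.semigroup 0 = ContinuousLinearMap.id ℝ E := by
  ext x
  refine tendsto_nhds_unique (hT.tendsto_semigroup 0 x) ?_
  simp [expOp_zero]

theorem semigroup_add (s t : ℝ≥0) :
    hT.semigroup (s + t) = (hT.semigroup s).comp (hT.semigroup t) := by
  ext x
  refine tendsto_nhds_unique (hT.tendsto_semigroup (s + t) x) ?_
  refine (hT.tendsto_semigroup_seq s (hT.tendsto_semigroup t x)).congr fun n => ?_
  rw [NNReal.coe_add, expOp_add]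
  rfl

theorem dist_semigroup_le (x : T.domain) (s t : ℝ≥0) :
    dist (hT.semigroup s x) (hT.semigroup t x) ≤ ‖T x‖ * dist s t := by
  refine le_of_tendsto ((hT.tendsto_semigroup s x).dist (hT.tendsto_semigroup t x))
    (Eventually.of_forall fun n => ?_)
  rw [dist_eq_norm, NNReal.dist_eq, ← Real.norm_eq_abs]
  refine Convex.norm_image_sub_le_of_norm_hasDerivWithin_le (s := Ici (0 : ℝ))
    (fun r _ => (hasDerivAt_expOp_apply (hT.yosida (param n)) (x : E) r).hasDerivWithinAt)
    (fun r hr => ?_) (convex_Ici 0) t.2 s.2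
  exact (hT.norm_expOp_yosida_le n hr _).trans (hT.norm_yosida_apply_le _ x)

/-- Orbits starting in the domain are Lipschitz, and by contractivity any orbit is a uniform limit
of these. -/
theorem continuous_semigroup (z : E) : Continuous fun t => hT.semigroup t z := by
  refine continuous_of_uniform_approx_of_continuous fun u hu => ?_
  obtain ⟨ε, hε, hsub⟩ := Metric.mem_uniformity_dist.1 hu
  obtain ⟨y, hy, hyd⟩ := Metric.dense_iff.1 hT.dense_domain z ε hε
  refine ⟨fun t => hT.semigroup t y, ?_, fun t => hsub ?_⟩
  · exact (LipschitzWith.of_dist_le_mul (K := ‖T ⟨y, hyd⟩‖₊)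
      (hT.dist_semigroup_le ⟨y, hyd⟩)).continuous
  · rw [dist_eq_norm, ← map_sub]
    refine (hT.norm_semigroup_apply_le t _).trans_lt ?_
    rwa [← dist_eq_norm, dist_comm]

theorem isContractionSemigroup : IsContractionSemigroup hT.semigroup where
  zero := hT.semigroup_zero
  add := hT.semigroup_add
  continuous := hT.continuous_semigroup
  contraction t := ContinuousLinearMap.opNorm_le_bound _ zero_le_one fun x => by
    rw [one_mul]; exact hT.norm_semigroup_apply_le t x

/-- Limit of the same formula for the Yosida approximations, whose integrands are bounded by `‖T
x‖`. -/
theorem semigroup_sub_eq_integral (x : T.domain) (t : ℝ≥0) :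
    hT.semigroup t x - x = ∫ s in (0 : ℝ)..t, hT.semigroup s.toNNReal (T x) := by
  have h1 : ∀ n, expOp (hT.yosida (param n)) t (x : E) - x =
      ∫ s in (0 : ℝ)..t, expOp (hT.yosida (param n)) s (hT.yosida (param n) x) := by
    intro n
    rw [intervalIntegral.integral_eq_sub_of_hasDerivAt
      (fun s _ => hasDerivAt_expOp_apply (hT.yosida (param n)) (x : E) s)
      ((continuous_expOp_apply _ _).intervalIntegrable _ _), expOp_zero, one_apply_eq_self]
  refine tendsto_nhds_unique ((hT.tendsto_semigroup t x).sub_const (x : E)) ?_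
  simp_rw [h1]
  refine intervalIntegral.tendsto_integral_filter_of_dominated_convergence (fun _ => ‖T x‖)
    (Eventually.of_forall fun n => (continuous_expOp_apply _ _).aestronglyMeasurable)
    (Eventually.of_forall fun n => Eventually.of_forall fun s hs => ?_)
    (by simp) (Eventually.of_forall fun s hs => ?_)
  · rw [uIoc_of_le (NNReal.coe_nonneg t)] at hs
    exact (hT.norm_expOp_yosida_le n hs.1.le _).trans (hT.norm_yosida_apply_le _ x)
  · rw [uIoc_of_le (NNReal.coe_nonneg t)] at hs
    have := hT.tendsto_semigroup_seq s.toNNReal (hT.tendsto_yosida x)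
    rwa [Real.coe_toNNReal _ hs.1.le] at this

end IsMaximalDissipative

theorem tendsto_coe_nhdsGT_zero : Tendsto (fun h : ℝ≥0 => (h : ℝ)) (𝓝[>] 0) (𝓝[≠] 0) := by
  refine tendsto_nhdsWithin_iff.2 ⟨?_, ?_⟩
  · exact (NNReal.continuous_coe.tendsto 0).mono_left nhdsWithin_le_nhds
  · filter_upwards [self_mem_nhdsWithin] with h hh
    exact (NNReal.coe_pos.2 hh).ne'

theorem hasDerivAt_primitive [CompleteSpace E] {Z : ℝ → E} (hZ : Continuous Z) (t : ℝ) :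
    HasDerivAt (fun t => ∫ s in (0 : ℝ)..t, Z s) (Z t) t :=
  intervalIntegral.integral_hasDerivAt_right (hZ.intervalIntegrable _ _)
    (hZ.stronglyMeasurableAtFilter _ _) hZ.continuousAt

/-- The integral formula shows that the generator extends `T`. A generator of contractions is
dissipative, and a maximal dissipative operator has no proper dissipative extension: if `z` is in
the generator's domain with value `y`, solve `x - T x = z - y`; then `‖z - x‖² = ⟪y - T x, z - x⟫ ≤
0`, so `z = x`. -/
theorem IsMaximalDissipative.hasGenerator [CompleteSpace E] {T : E →ₗ.[ℝ] E}
    (hT : IsMaximalDissipative T) : HasGenerator hT.semigroup T := by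
  have hder : ∀ x : T.domain,
      Tendsto (fun h : ℝ≥0 => (h : ℝ)⁻¹ • (hT.semigroup h x - x)) (𝓝[>] 0) (𝓝 (T x)) := by
    intro x
    have hc : Continuous fun s : ℝ => hT.semigroup s.toNNReal (T x) :=
      (hT.continuous_semigroup _).comp continuous_real_toNNReal
    have h1 := (hasDerivAt_primitive hc 0).tendsto_slope_zero.comp tendsto_coe_nhdsGT_zero
    simp only [Real.toNNReal_zero, hT.semigroup_zero, ContinuousLinearMap.id_apply] at h1
    refine h1.congr fun h => ?_
    simp [hT.semigroup_sub_eq_integral]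
  intro z y
  refine ⟨fun ⟨h, hy⟩ => hy ▸ hder ⟨z, h⟩, fun h => ?_⟩
  obtain ⟨x, hx⟩ := hT.surjective 1 one_pos (z - y)
  rw [one_smul] at hx
  have h1 := h.sub (hder x)
  have h2 : y - T x = z - x := by
    rw [sub_eq_sub_iff_add_eq_add] at hx ⊢
    rw [add_comm y, hx]
  have h3 : ⟪y - T x, z - x⟫_ℝ ≤ 0 := by
    refine le_of_tendsto (h1.inner tendsto_const_nhds) (Eventually.of_forall fun k => ?_)
    have e : (k : ℝ)⁻¹ • (hT.semigroup k z - z) - (k : ℝ)⁻¹ • (hT.semigroup k x - x) =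
        (k : ℝ)⁻¹ • (hT.semigroup k (z - x) - (z - x)) := by
      rw [map_sub]; module
    rw [e, real_inner_smul_left, inner_sub_left, real_inner_self_eq_norm_sq]
    refine mul_nonpos_of_nonneg_of_nonpos (by positivity) ?_
    have := real_inner_le_norm (hT.semigroup k (z - x)) (z - x)
    nlinarith [mul_le_mul_of_nonneg_right (hT.norm_semigroup_apply_le k (z - x))
      (norm_nonneg (z - (x : E)))]
  rw [h2, real_inner_self_eq_norm_sq] at h3
  have h4 : z = x := by
    have : ‖z - x‖ ^ 2 = 0 := le_antisymm h3 (sq_nonneg _)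
    exact sub_eq_zero.1 (by simpa using this)
  subst h4
  exact ⟨x.2, (sub_eq_zero.1 (h2.trans (sub_self _))).symm⟩

variable {T : E →ₗ.[ℝ] E} {S : ℝ≥0 → E →L[ℝ] E}

theorem IsContractionSemigroup.isMildSolution [CompleteSpace E] (hS : IsContractionSemigroup S)
    (hg : HasGenerator S T) (z : E) : IsMildSolution T z fun t => S t.toNNReal z := by
  have hc : Continuous fun t : ℝ => S t.toNNReal z := (hS.continuous z).comp continuous_real_toNNReal
  refine ⟨hc.continuousOn, fun t ht => ?_⟩
  suffices h : Tendsto (fun k : ℝ≥0 => (k : ℝ)⁻¹ • (S k (∫ s in (0 : ℝ)..t, S s.toNNReal z) -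
      ∫ s in (0 : ℝ)..t, S s.toNNReal z)) (𝓝[>] 0) (𝓝 (S t.toNNReal z - z)) by
    obtain ⟨h, e⟩ := (hg _ _).2 h
    exact ⟨h, by rw [e, add_sub_cancel]⟩
  have h1 := (hasDerivAt_primitive hc t).tendsto_slope_zero.comp tendsto_coe_nhdsGT_zero
  have h2 := (hasDerivAt_primitive hc 0).tendsto_slope_zero.comp tendsto_coe_nhdsGT_zero
  simp only [Real.toNNReal_zero, hS.zero, ContinuousLinearMap.id_apply] at h2
  refine (h1.sub h2).congr fun k => ?_
  have hi : ∀ a b, IntervalIntegrable (fun t : ℝ => S t.toNNReal z) volume a b :=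
    fun a b => hc.intervalIntegrable a b
  -- Applying `S k` translates the interval of integration, so the difference quotient is that of
  -- `∫ₜ^(t+k)` minus that of `∫₀^k`.
  have e1 : S k (∫ s in (0 : ℝ)..t, S s.toNNReal z) =
      ∫ s in (k : ℝ)..(t + k), S s.toNNReal z := by
    rw [← (S k).intervalIntegral_comp_comm (hi _ _)]
    have := intervalIntegral.integral_comp_add_right (a := 0) (b := t)
      (fun s : ℝ => S s.toNNReal z) (k : ℝ)
    rw [zero_add] at this
    rw [← this]
    refine intervalIntegral.integral_congr fun s hs => ?_
    rw [uIcc_of_le ht] at hs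
    have : (s + k).toNNReal = k + s.toNNReal := by
      rw [Real.toNNReal_add hs.1 k.coe_nonneg, Real.toNNReal_coe, add_comm]
    simp only [this, hS.add]
    rfl
  have e2 := intervalIntegral.integral_add_adjacent_intervals (hi 0 k) (hi k (t + k))
  simp only [Function.comp_apply, zero_add, intervalIntegral.integral_same, sub_zero]
  rw [← smul_sub, e1, ← e2]
  congr 1
  abel

/-- The integrated difference `U` of two solutions satisfies `U' = T U` and `U(0) = 0`, so `‖U‖²` is
nonincreasing and `U = 0`. Then `Z - W = T U = 0`. -/
theorem IsMildSolution.eq_of_dissipative [CompleteSpace E]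
    (hT : ∀ x : T.domain, ⟪T x, (x : E)⟫_ℝ ≤ 0) {z : E} {Z W : ℝ → E}
    (hZ : IsMildSolution T z Z) (hW : IsMildSolution T z W) {t : ℝ} (ht : 0 ≤ t) : Z t = W t := by
  -- Composing with `max t 0` extends solutions continuously to negative times, so that primitives
  -- have genuine derivatives at `0` too.
  have hcont : ∀ {Y : ℝ → E}, ContinuousOn Y (Ici 0) → Continuous fun t => Y (max t 0) :=
    fun hY => hY.comp_continuous (by fun_prop) fun t => mem_Ici.2 (le_max_right _ _)
  have hZc := hcont hZ.continuousOn
  have hWc := hcont hW.continuousOn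
  set U : ℝ → E := fun t => (∫ s in (0 : ℝ)..t, Z (max s 0)) - ∫ s in (0 : ℝ)..t, W (max s 0)
    with hU
  have hd : ∀ t, HasDerivAt U (Z (max t 0) - W (max t 0)) t := fun t =>
    (hasDerivAt_primitive hZc t).sub (hasDerivAt_primitive hWc t)
  have hint : ∀ (Y : ℝ → E) {t : ℝ}, 0 ≤ t →
      ∫ s in (0 : ℝ)..t, Y (max s 0) = ∫ s in (0 : ℝ)..t, Y s := by
    intro Y t ht
    refine intervalIntegral.integral_congr fun s hs => ?_
    rw [uIcc_of_le ht] at hs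
    simp only [max_eq_left hs.1]
  have hTU : ∀ t, 0 ≤ t → ∃ h : U t ∈ T.domain, T ⟨U t, h⟩ = Z (max t 0) - W (max t 0) := by
    intro t ht
    obtain ⟨h1, e1⟩ := hZ.integral_eq t ht
    obtain ⟨h2, e2⟩ := hW.integral_eq t ht
    have e : U t = (∫ s in (0 : ℝ)..t, Z s) - ∫ s in (0 : ℝ)..t, W s := by
      simp only [hU, hint _ ht]
    have h : U t ∈ T.domain := e ▸ T.domain.sub_mem h1 h2
    refine ⟨h, ?_⟩
    have e3 : (⟨U t, h⟩ : T.domain) = ⟨_, h1⟩ - ⟨_, h2⟩ := Subtype.ext e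
    rw [e3, LinearPMap.map_sub, max_eq_left ht, e1, e2, add_sub_add_left_eq_sub]
  have hanti : AntitoneOn (fun t => ‖U t‖ ^ 2) (Ici 0) := by
    refine antitoneOn_of_deriv_nonpos (convex_Ici 0)
      (fun t _ => (hd t).norm_sq.continuousAt.continuousWithinAt)
      (fun t _ => (hd t).norm_sq.differentiableAt.differentiableWithinAt) fun t ht => ?_
    rw [interior_Ici] at ht
    obtain ⟨h, e⟩ := hTU t (le_of_lt ht)
    rw [(hd t).norm_sq.deriv, ← e, real_inner_comm]
    exact mul_nonpos_of_nonneg_of_nonpos zero_le_two (hT ⟨U t, h⟩)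
  have hU0 : U t = 0 := by
    have h1 := hanti (mem_Ici.2 le_rfl) ht ht
    have h2 : U 0 = 0 := by simp [hU]
    simp only [h2] at h1
    have : ‖U t‖ ^ 2 = 0 := le_antisymm (by simpa using h1) (sq_nonneg _)
    simpa using this
  obtain ⟨h, e⟩ := hTU t ht
  have h3 : (⟨U t, h⟩ : T.domain) = 0 := Subtype.ext hU0
  rw [h3, LinearPMap.map_zero, max_eq_left ht] at e
  exact sub_eq_zero.1 e.symm

/-- The orbits of both semigroups are mild solutions with the same initial datum. -/
theorem IsContractionSemigroup.eq_of_hasGenerator [CompleteSpace E]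
    (hT : ∀ x : T.domain, ⟪T x, (x : E)⟫_ℝ ≤ 0) (hS : IsContractionSemigroup S)
    (hg : HasGenerator S T) {S' : ℝ≥0 → E →L[ℝ] E} (hS' : IsContractionSemigroup S')
    (hg' : HasGenerator S' T) : S' = S := by
  funext t
  ext z
  have := (hS'.isMildSolution hg' z).eq_of_dissipative hT (hS.isMildSolution hg z) t.coe_nonneg
  rwa [Real.toNNReal_coe] at this

theorem IsContractionSemigroup.map_generator (hS : IsContractionSemigroup S)
    (hg : HasGenerator S T) (x : T.domain) (t : ℝ≥0) :
    ∃ h : S t x ∈ T.domain, T ⟨S t x, h⟩ = S t (T x) := by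
  rw [hg]
  have h1 := ((S t).continuous.tendsto _).comp ((hg x (T x)).1 ⟨x.2, rfl⟩)
  refine h1.congr fun h => ?_
  have e : S h (S t x) = S t (S h x) := by
    have h2 := DFunLike.congr_fun (hS.add h t) (x : E)
    rw [add_comm, hS.add] at h2
    exact h2.symm
  simp only [Function.comp_apply, map_smul, map_sub, e]

/-- The orbit is `x` plus the primitive of the continuous function `S(s) T x`, and `S(t) T x = T
S(t) x`. -/
theorem IsMaximalDissipative.hasDerivWithinAt_norm_sq [CompleteSpace E]
    (hT : IsMaximalDissipative T) (x : T.domain) (t : ℝ≥0) (h : hT.semigroup t x ∈ T.domain) :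
    HasDerivWithinAt (fun r : ℝ => ‖hT.semigroup r.toNNReal x‖ ^ 2)
      (2 * ⟪T ⟨hT.semigroup t x, h⟩, hT.semigroup t x⟫_ℝ) (Ici 0) t := by
  have hc : Continuous fun s : ℝ => hT.semigroup s.toNNReal (T x) :=
    (hT.continuous_semigroup _).comp continuous_real_toNNReal
  obtain ⟨h', e⟩ := hT.isContractionSemigroup.map_generator hT.hasGenerator x t
  have h1 : HasDerivWithinAt (fun r : ℝ => hT.semigroup r.toNNReal x)
      (T ⟨hT.semigroup t x, h⟩) (Ici 0) t := by
    rw [e]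
    have h2 := ((hasDerivAt_primitive hc t).const_add (x : E)).hasDerivWithinAt (s := Ici 0)
    rw [Real.toNNReal_coe] at h2
    refine h2.congr (fun r hr => ?_) ?_
    · have := hT.semigroup_sub_eq_integral x r.toNNReal
      rw [Real.coe_toNNReal _ hr] at this
      rw [← this, add_sub_cancel]
    · rw [Real.toNNReal_coe, ← hT.semigroup_sub_eq_integral, add_sub_cancel]
  have h2 := h1.norm_sq
  rw [Real.toNNReal_coe, real_inner_comm] at h2
  exact h2

end Semigroup

/-! ### Inversion of `c - P` by an exponential kernel. -/

section Resolvent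

variable {ℓ : EReal} {μ : ℝ → ℝ}

/-- The kernel of the resolvent of `d/dτ`. -/
noncomputable def expKernel (c : ℝ) : ℝ → ℝ := (Iio 0).indicator fun u => Real.exp (c * u)

theorem integrable_expKernel {c : ℝ} (hc : 0 < c) : Integrable (expKernel c) :=
  (integrable_indicator_iff measurableSet_Iio).2
    ((integrableOn_exp_mul_Iic hc 0).mono_set Iio_subset_Iic_self)

theorem expKernel_nonneg (c u : ℝ) : 0 ≤ expKernel c u :=
  indicator_nonneg (fun _ _ => (Real.exp_pos _).le) _

section

variable {X : Type*} [NormedAddCommGroup X] [NormedSpace ℝ X]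

/-- The function `τ ↦ ∫_τ^ℓ exp (c (τ - s)) h(s) ds`. -/
noncomputable def expTail (ℓ : EReal) (c : ℝ) (h : ℝ → X) (τ : ℝ) : X :=
  Real.exp (c * τ) • tail ((memInterval ℓ).indicator fun s => Real.exp (-(c * s)) • h s) τ

theorem integrable_exp_smul {c : ℝ} (hc : 0 < c) {h : ℝ → X}
    (hh : IntegrableOn h (memInterval ℓ)) :
    Integrable ((memInterval ℓ).indicator fun s => Real.exp (-(c * s)) • h s) := by
  rw [integrable_indicator_iff (measurableSet_memInterval ℓ)]
  refine Integrable.bdd_smul hh 1 (by fun_prop) ?_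
  filter_upwards [ae_restrict_mem (measurableSet_memInterval ℓ)] with s hs
  rw [Real.norm_of_nonneg (Real.exp_pos _).le, Real.exp_le_one_iff]
  have := mul_pos hc hs.1
  linarith

theorem continuous_expTail {c : ℝ} (hc : 0 < c) {h : ℝ → X} (hh : IntegrableOn h (memInterval ℓ)) :
    Continuous (expTail ℓ c h) :=
  (by fun_prop : Continuous fun τ : ℝ => Real.exp (c * τ)).smul
    (continuous_tail (integrable_exp_smul hc hh))

theorem expTail_eq_integral (c : ℝ) (h : ℝ → X) (τ : ℝ) :
    expTail ℓ c h τ = ∫ s in memInterval ℓ ∩ Ioi τ, Real.exp (c * (τ - s)) • h s := by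
  rw [expTail, tail, setIntegral_indicator (measurableSet_memInterval ℓ), inter_comm,
    ← integral_smul]
  refine integral_congr_ae (Eventually.of_forall fun s => ?_)
  simp only [smul_smul, ← Real.exp_add]
  ring_nf

theorem expTail_congr {c : ℝ} {h k : ℝ → X} (hk : h =ᵐ[volume.restrict (memInterval ℓ)] k) :
    expTail ℓ c h = expTail ℓ c k := by
  ext τ
  rw [expTail_eq_integral, expTail_eq_integral]
  refine integral_congr_ae ?_
  filter_upwards [ae_restrict_of_ae_restrict_of_subset inter_subset_left hk] with s hs
  rw [hs]

theorem norm_expTail_le {c : ℝ} (hc : 0 < c) {h : ℝ → X} (hh : IntegrableOn h (memInterval ℓ))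
    (τ : ℝ) : ‖expTail ℓ c h τ‖ ≤ tail ((memInterval ℓ).indicator fun s => ‖h s‖) τ := by
  rw [expTail_eq_integral, tail, setIntegral_indicator (measurableSet_memInterval ℓ), inter_comm]
  have hn : IntegrableOn (fun s => ‖h s‖) (memInterval ℓ) := hh.norm
  refine norm_integral_le_of_norm_le (hn.mono_set inter_subset_right) ?_
  filter_upwards [ae_restrict_mem (measurableSet_Ioi.inter (measurableSet_memInterval ℓ))]
    with s hs
  rw [norm_smul, Real.norm_of_nonneg (Real.exp_pos _).le]
  refine mul_le_of_le_one_left (norm_nonneg _) (Real.exp_le_one_iff.2 ?_)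
  have : τ < s := hs.1
  nlinarith

theorem tendsto_expTail {c : ℝ} (hc : 0 < c) {h : ℝ → X} (hh : IntegrableOn h (memInterval ℓ)) :
    Tendsto (expTail ℓ c h) (rightEnd ℓ) (𝓝 0) := by
  refine squeeze_zero_norm (norm_expTail_le hc hh) (tendsto_tail_rightEnd ?_ ?_)
  · exact (integrable_indicator_iff (measurableSet_memInterval ℓ)).2 hh.norm
  · exact fun s hs => indicator_of_notMem hs _

/-- The factor `exp (c τ)` is moved onto the test function. Differentiating `φ(τ) exp (c τ)`
produces the additional term `c ξ`. -/
theorem isDistribDeriv_expTail [CompleteSpace X] {c : ℝ} (hc : 0 < c) {h : ℝ → X}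
    (hh : IntegrableOn h (memInterval ℓ)) :
    IsDistribDeriv ℓ (expTail ℓ c h) fun τ => c • expTail ℓ c h τ - h τ := by
  intro φ hφ hφc hφs
  have hgi := integrable_exp_smul hc hh
  set g := (memInterval ℓ).indicator fun s => Real.exp (-(c * s)) • h s with hg
  have hexp : ContDiff ℝ ∞ fun τ : ℝ => Real.exp (c * τ) := by fun_prop
  have hψ : ContDiff ℝ ∞ fun τ => φ τ * Real.exp (c * τ) := hφ.mul hexp
  have hψc : HasCompactSupport fun τ => φ τ * Real.exp (c * τ) := hφc.mul_right
  have hd : ∀ τ, deriv (fun τ => φ τ * Real.exp (c * τ)) τ =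
      deriv φ τ * Real.exp (c * τ) + c * (φ τ * Real.exp (c * τ)) := by
    intro τ
    have h1 := ((hφ.differentiable (by simp)) τ).hasDerivAt
    have h2 : HasDerivAt (fun τ : ℝ => Real.exp (c * τ)) (Real.exp (c * τ) * (c * 1)) τ :=
      ((hasDerivAt_id τ).const_mul c).exp
    refine (h1.mul h2).deriv.trans ?_
    ring
  have hξc := continuous_expTail hc hh
  have hφi : Integrable fun τ => φ τ • expTail ℓ c h τ :=
    (hφ.continuous.smul hξc).integrable_of_hasCompactSupport hφc.smul_right
  have hφd : Integrable fun τ => deriv φ τ • expTail ℓ c h τ :=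
    ((hφ.continuous_deriv (by simp)).smul hξc).integrable_of_hasCompactSupport hφc.deriv.smul_right
  have hφh : IntegrableOn (fun τ => φ τ • h τ) (memInterval ℓ) := by
    obtain ⟨C, hC⟩ := hφ.continuous.bounded_above_of_compact_support hφc
    exact hh.bdd_smul C hφ.continuous.aestronglyMeasurable (Eventually.of_forall hC)
  have key := integral_deriv_smul_tail hgi hψ hψc
  have e1 : ∫ τ, deriv (fun τ => φ τ * Real.exp (c * τ)) τ • tail g τ =
      (∫ τ, deriv φ τ • expTail ℓ c h τ) + c • ∫ τ, φ τ • expTail ℓ c h τ := by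
    have hφc' : Integrable fun τ => c • φ τ • expTail ℓ c h τ := hφi.smul c
    rw [← integral_smul, ← integral_add hφd hφc']
    refine integral_congr_ae (Eventually.of_forall fun τ => ?_)
    simp only [hd, expTail, ← hg]
    module
  have e2 : ∫ τ, (φ τ * Real.exp (c * τ)) • g τ = ∫ τ in memInterval ℓ, φ τ • h τ := by
    rw [← integral_indicator (measurableSet_memInterval ℓ)]
    refine integral_congr_ae (Eventually.of_forall fun τ => ?_)
    by_cases hτ : τ ∈ memInterval ℓ
    · simp only [hg, indicator_of_mem hτ, smul_smul, mul_assoc, ← Real.exp_add, add_neg_cancel,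
        Real.exp_zero, mul_one]
    · simp only [hg, indicator_of_notMem hτ, smul_zero]
  rw [e1, e2] at key
  simp only [smul_sub, smul_comm (φ _) c]
  have hφi' : IntegrableOn (fun τ => c • φ τ • expTail ℓ c h τ) (memInterval ℓ) :=
    (hφi.smul c).integrableOn
  rw [integral_sub hφi' hφh, integral_smul, setIntegral_smul_eq ((tsupport_deriv_subset).trans hφs),
    setIntegral_smul_eq hφs (expTail ℓ c h), ← key]
  abel

end

namespace IsMemoryKernel

variable {X : Type*} [NormedAddCommGroup X] [InnerProductSpace ℝ X]

/-- Cauchy–Schwarz with weight `exp (c (τ - s))` bounds `‖ξ(τ)‖²` by the product of the weighted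
integrals of `μ` and `ν ‖h‖²` over `s > τ`. There `μ(s) ≤ μ(τ)`, so the first is at most `C μ(τ)`,
with `C` the integral of `expKernel`, and `μ(τ)` cancels `ν(τ)`. The second is dominated by a
convolution of integrable functions, hence is integrable in `τ`. -/
theorem memLp_expTail (hμ : IsMemoryKernel ℓ μ) {c : ℝ} (hc : 0 < c) (h : StateSpace ℓ μ X) :
    MemLp (expTail ℓ c h) 2 (stateMeasure ℓ μ) := by
  have hh := hμ.integrable_coe h
  have hξc := continuous_expTail hc hh
  rw [hμ.memLp_iff hξc.aestronglyMeasurable]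
  set w := (memInterval ℓ).indicator fun s => nu μ s * ‖h s‖ ^ 2 with hw
  have hwi : Integrable w :=
    (integrable_indicator_iff (measurableSet_memInterval ℓ)).2 (hμ.integrableOn_norm_sq h)
  have hw0 : ∀ s, 0 ≤ w s := fun s =>
    indicator_nonneg (fun s hs => mul_nonneg (hμ.nu_pos hs).le (sq_nonneg _)) s
  set C := ∫ u, expKernel c u
  have hC : 0 ≤ C := integral_nonneg fun u => expKernel_nonneg c u
  have hJ : Integrable fun τ => ∫ s, w s * expKernel c (τ - s) :=
    hwi.integrable_convolution (ContinuousLinearMap.mul ℝ ℝ) (integrable_expKernel hc)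
  have hnu : AEStronglyMeasurable (nu μ) (volume.restrict (memInterval ℓ)) :=
    (hμ.aemeasurable.const_div 1).aestronglyMeasurable
  refine ((hJ.const_mul C).integrableOn (s := memInterval ℓ)).mono'
    (hnu.mul (hξc.norm.pow 2).aestronglyMeasurable) ?_
  filter_upwards [ae_restrict_mem (measurableSet_memInterval ℓ),
    ae_restrict_of_ae (hwi.ae_convolution_exists (ContinuousLinearMap.mul ℝ ℝ)
      (integrable_expKernel hc))] with τ hτ hτJ
  have hτJ' : Integrable fun s => w s * expKernel c (τ - s) := hτJ
  have hm : MeasurableSet (memInterval ℓ ∩ Ioi τ) :=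
    (measurableSet_memInterval ℓ).inter measurableSet_Ioi
  have hk : ∀ s ∈ memInterval ℓ ∩ Ioi τ, expKernel c (τ - s) = Real.exp (c * (τ - s)) :=
    fun s hs =>
      indicator_of_mem (s := Iio 0) (mem_Iio.2 (sub_neg.2 (mem_Ioi.1 hs.2))) fun u => Real.exp (c * u)
  have hle : ∀ s ∈ memInterval ℓ ∩ Ioi τ, ‖Real.exp (c * (τ - s))‖ ≤ 1 := fun s hs => by
    rw [Real.norm_of_nonneg (Real.exp_pos _).le, Real.exp_le_one_iff]
    have : τ < s := hs.2
    nlinarith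
  have hle' : ∀ᵐ s ∂volume.restrict (memInterval ℓ ∩ Ioi τ), ‖Real.exp (c * (τ - s))‖ ≤ 1 := by
    filter_upwards [ae_restrict_mem hm] with s hs using hle s hs
  have hem : AEStronglyMeasurable (fun s => Real.exp (c * (τ - s)))
      (volume.restrict (memInterval ℓ ∩ Ioi τ)) := by fun_prop
  have hp : IntegrableOn (fun s => Real.exp (c * (τ - s)) * μ s) (memInterval ℓ ∩ Ioi τ) :=
    (hμ.integrable.mono_set inter_subset_left).bdd_mul hem hle'
  have hq : IntegrableOn (fun s => Real.exp (c * (τ - s)) * (nu μ s * ‖h s‖ ^ 2))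
      (memInterval ℓ ∩ Ioi τ) :=
    ((hμ.integrableOn_norm_sq h).mono_set inter_subset_left).bdd_mul hem hle'
  have hf : IntegrableOn (fun s => Real.exp (c * (τ - s)) * ‖h s‖) (memInterval ℓ ∩ Ioi τ) :=
    (IntegrableOn.mono_set (f := fun s => ‖h s‖) hh.norm inter_subset_left).bdd_mul hem hle'
  have hcs := sq_integral_le_mul_integral hf hp hq (by
    filter_upwards [ae_restrict_mem hm] with s hs
    have h1 := hμ.pos s hs.1
    have h2 := hμ.nu_pos hs.1
    refine ⟨by positivity, by positivity, le_of_eq ?_⟩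
    have h3 := hμ.mul_nu hs.1
    calc (Real.exp (c * (τ - s)) * ‖h s‖) ^ 2 =
          Real.exp (c * (τ - s)) ^ 2 * ‖h s‖ ^ 2 * 1 := by ring
      _ = _ := by rw [← h3]; ring)
  have h1 : ‖expTail ℓ c h τ‖ ≤ ∫ s in memInterval ℓ ∩ Ioi τ, Real.exp (c * (τ - s)) * ‖h s‖ := by
    rw [expTail_eq_integral]
    refine (norm_integral_le_integral_norm _).trans_eq ?_
    refine integral_congr_ae (Eventually.of_forall fun s => ?_)
    simp only [norm_smul, Real.norm_of_nonneg (Real.exp_pos _).le]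
  have hkc : Integrable fun s => expKernel c (τ - s) := (integrable_expKernel hc).comp_sub_left τ
  have h2 : ∫ s in memInterval ℓ ∩ Ioi τ, Real.exp (c * (τ - s)) * μ s ≤ C * μ τ := by
    calc _ ≤ ∫ s in memInterval ℓ ∩ Ioi τ, expKernel c (τ - s) * μ τ := by
          refine setIntegral_mono_on hp (hkc.mul_const _).integrableOn hm fun s hs => ?_
          rw [hk s hs]
          exact mul_le_mul_of_nonneg_left (hμ.antitone hτ hs.1 (le_of_lt hs.2)) (Real.exp_pos _).le
      _ ≤ ∫ s, expKernel c (τ - s) * μ τ :=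
          setIntegral_le_integral (hkc.mul_const _) (Eventually.of_forall fun s =>
            mul_nonneg (expKernel_nonneg _ _) (hμ.pos τ hτ).le)
      _ = C * μ τ := by rw [integral_mul_const, integral_sub_left_eq_self]
  have h3 : ∫ s in memInterval ℓ ∩ Ioi τ, Real.exp (c * (τ - s)) * (nu μ s * ‖h s‖ ^ 2) ≤
      ∫ s, w s * expKernel c (τ - s) := by
    refine le_trans (le_of_eq ?_) (setIntegral_le_integral hτJ' (s := memInterval ℓ ∩ Ioi τ)
      (Eventually.of_forall fun s => mul_nonneg (hw0 s) (expKernel_nonneg _ _)))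
    refine setIntegral_congr_fun hm fun s hs => ?_
    simp only [hk s hs, hw, indicator_of_mem hs.1, mul_comm]
  have hν := hμ.nu_pos hτ
  rw [Real.norm_of_nonneg (by positivity)]
  have h4 : ‖expTail ℓ c h τ‖ ^ 2 ≤ C * μ τ * ∫ s, w s * expKernel c (τ - s) := by
    refine (pow_le_pow_left₀ (norm_nonneg _) h1 2).trans (hcs.trans ?_)
    refine mul_le_mul h2 h3 ?_ (mul_nonneg hC (hμ.pos τ hτ).le)
    exact setIntegral_nonneg hm fun s hs =>
      mul_nonneg (Real.exp_pos _).le (mul_nonneg (hμ.nu_pos hs.1).le (sq_nonneg _))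
  calc nu μ τ * ‖expTail ℓ c h τ‖ ^ 2 ≤
        nu μ τ * (C * μ τ * ∫ s, w s * expKernel c (τ - s)) := by gcongr
    _ = μ τ * nu μ τ * (C * ∫ s, w s * expKernel c (τ - s)) := by ring
    _ = _ := by rw [hμ.mul_nu hτ, one_mul]

variable [CompleteSpace X]

theorem derivOp_eq (hμ : IsMemoryKernel ℓ μ) {ξ g : StateSpace ℓ μ X}
    (hξ : ξ ∈ (hμ.derivOp (X := X)).domain) (hg : IsDistribDeriv ℓ ξ g) :
    hμ.derivOp ⟨ξ, hξ⟩ = g :=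
  hμ.isDistribDeriv_unique (hμ.derivOp_spec ⟨ξ, hξ⟩) hg

/-- The operator `c - P` is onto. -/
theorem exists_smul_sub_derivOp_eq (hμ : IsMemoryKernel ℓ μ) {c : ℝ} (hc : 0 < c)
    (h : StateSpace ℓ μ X) : ∃ ξ : (hμ.derivOp (X := X)).domain,
      hμ.derivOp ξ = c • (ξ : StateSpace ℓ μ X) - h ∧
      (ξ : StateSpace ℓ μ X) =ᵐ[volume.restrict (memInterval ℓ)] expTail ℓ c h := by
  have hh := hμ.integrable_coe h
  have hmem := hμ.memLp_expTail hc h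
  set ξ : StateSpace ℓ μ X := hmem.toLp _ with hξ
  have hae : ξ =ᵐ[volume.restrict (memInterval ℓ)] expTail ℓ c h :=
    hμ.ac_stateMeasure.ae_eq hmem.coeFn_toLp
  have hae2 : (c • ξ - h : StateSpace ℓ μ X) =ᵐ[volume.restrict (memInterval ℓ)]
      fun τ => c • expTail ℓ c h τ - h τ := by
    filter_upwards [hμ.ac_stateMeasure.ae_eq (Lp.coeFn_sub (c • ξ) h),
      hμ.ac_stateMeasure.ae_eq (Lp.coeFn_smul c ξ), hae] with τ h1 h2 h3
    rw [h1, Pi.sub_apply, h2, Pi.smul_apply, h3]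
  have hd : IsDistribDeriv ℓ ξ (c • ξ - h : StateSpace ℓ μ X) := by
    intro φ hφ hφc hφs
    have e1 : ∫ τ in memInterval ℓ, deriv φ τ • ξ τ =
        ∫ τ in memInterval ℓ, deriv φ τ • expTail ℓ c h τ :=
      integral_congr_ae (by filter_upwards [hae] with τ h1; rw [h1])
    have e2 : ∫ τ in memInterval ℓ, φ τ • (c • ξ - h : StateSpace ℓ μ X) τ =
        ∫ τ in memInterval ℓ, φ τ • (c • expTail ℓ c h τ - h τ) :=
      integral_congr_ae (by filter_upwards [hae2] with τ h1; rw [h1])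
    rw [e1, e2]
    exact isDistribDeriv_expTail hc hh φ hφ hφc hφs
  have hdom : ξ ∈ (hμ.derivOp (X := X)).domain := ⟨⟨_, hd⟩, _,
    ⟨(continuous_expTail hc hh).continuousOn, hae.symm⟩, tendsto_expTail hc hh⟩
  exact ⟨⟨ξ, hdom⟩, hμ.derivOp_eq hdom hd, hae⟩

/-- For the datum `μ v` the solution is a nonnegative scalar function times `v`, so its integral is
a multiple of `v`. The sign of `κ` keeps the elimination in `generatorOp_surjective` nondegenerate.
-/
theorem exists_smul_sub_derivOp_eq_kernelMul (hμ : IsMemoryKernel ℓ μ) {c : ℝ} (hc : 0 < c) :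
    ∃ κ : ℝ, 0 ≤ κ ∧ ∀ v : X, ∃ ξ : (hμ.derivOp (X := X)).domain,
      hμ.derivOp ξ = c • (ξ : StateSpace ℓ μ X) - hμ.kernelMul v ∧
      hμ.integralMap (ξ : StateSpace ℓ μ X) = κ • v := by
  refine ⟨∫ τ in memInterval ℓ, expTail ℓ c μ τ, ?_, fun v => ?_⟩
  · refine setIntegral_nonneg (measurableSet_memInterval ℓ) fun τ _ => ?_
    rw [expTail_eq_integral]
    exact setIntegral_nonneg ((measurableSet_memInterval ℓ).inter measurableSet_Ioi) fun s hs =>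
      mul_nonneg (Real.exp_pos _).le (hμ.pos s hs.1).le
  · obtain ⟨ξ, h1, h2⟩ := hμ.exists_smul_sub_derivOp_eq hc (hμ.kernelMul v)
    refine ⟨ξ, h1, ?_⟩
    have h3 : expTail ℓ c (hμ.kernelMul v) = fun τ => expTail ℓ c μ τ • v := by
      refine (expTail_congr
        (hμ.ac_stateMeasure.ae_eq (hμ.memLp_kernel_smul v).coeFn_toLp)).trans ?_
      ext τ
      rw [expTail_eq_integral, expTail_eq_integral, ← integral_smul_const]
      simp only [smul_eq_mul, mul_smul]
    rw [h3] at h2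
    exact (integral_congr_ae h2).trans (integral_smul_const _ _)

end IsMemoryKernel

end Resolvent

/-! ### Dissipativity and range condition for `generatorOp`. -/

section Generator

variable {H : Type*} [NormedAddCommGroup H] [InnerProductSpace ℝ H] [CompleteSpace H]
  {A : H →ₗ.[ℝ] H} (hA : IsStrictlyPositiveOp A) {ℓ : EReal} {μ : ℝ → ℝ}

open ExtendedStateSpace

theorem ExtendedStateSpace.inner_eq (z w : ExtendedStateSpace hA ℓ μ) :
    ⟪z, w⟫_ℝ = ⟪z.displ, w.displ⟫_ℝ + ⟪z.veloc, w.veloc⟫_ℝ + ⟪z.state, w.state⟫_ℝ := by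
  rw [WithLp.prod_inner_apply, WithLp.prod_inner_apply, ← add_assoc]
  rfl

/-- With `B = A^(1/2)`, `A w = B (B w)` and one factor `B` is moved to `v` by symmetry. -/
theorem inner_apply_eq_inner_energySpace (w : EnergySpace hA)
    (hw : EnergySpace.incl hA w ∈ A.domain) {v : H} (hv : v ∈ (sqrtOp hA).domain) :
    ⟪A ⟨EnergySpace.incl hA w, hw⟩, v⟫_ℝ = ⟪w, EnergySpace.mk hA v hv⟫_ℝ := by
  obtain ⟨h, h', e⟩ := ((sqrtOp_spec hA).sq (EnergySpace.incl hA w) _).1 ⟨hw, rfl⟩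
  rw [← e]
  exact EnergySpace.sqrtOp_formal hA ⟨_, h'⟩ ⟨v, hv⟩

theorem IsMemoryKernel.inner_kernelMul (hμ : IsMemoryKernel ℓ μ) {X : Type*} [NormedAddCommGroup X]
    [InnerProductSpace ℝ X] [CompleteSpace X] (v : X) (ξ : StateSpace ℓ μ X) :
    ⟪hμ.kernelMul v, ξ⟫_ℝ = ⟪v, hμ.integralMap ξ⟫_ℝ := by
  rw [hμ.inner_eq_integral]
  refine Eq.trans ?_ (integral_inner (hμ.integrable_coe ξ) v)
  refine integral_congr_ae ?_
  filter_upwards [hμ.ac_stateMeasure.ae_eq (hμ.memLp_kernel_smul v).coeFn_toLp,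
    ae_restrict_mem (measurableSet_memInterval ℓ)] with τ h1 h2
  have h3 : hμ.kernelMul v τ = μ τ • v := h1
  rw [h3, real_inner_smul_left, ← mul_assoc, mul_comm (nu μ τ), hμ.mul_nu h2, one_mul]

variable (hμ : IsMemoryKernel ℓ μ)

theorem inner_generatorOp (z : (generatorOp hA hμ).domain) :
    ⟪generatorOp hA hμ z, (z : ExtendedStateSpace hA ℓ μ)⟫_ℝ =
      ⟪z.1.state, hμ.derivOp ⟨z.1.state, state_mem hA hμ z.2⟩⟫_ℝ := by
  have h1 := inner_apply_eq_inner_energySpace hA (z.1.displ + hμ.integralMap z.1.state)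
    (integral_mem hA hμ z.2) (veloc_mem hA hμ z.2)
  have e1 : (generatorOp hA hμ z).displ = EnergySpace.mk hA z.1.veloc (veloc_mem hA hμ z.2) := rfl
  have e2 : (generatorOp hA hμ z).veloc =
    -A ⟨EnergySpace.incl hA (z.1.displ + hμ.integralMap z.1.state), integral_mem hA hμ z.2⟩ := rfl
  have e3 : (generatorOp hA hμ z).state = hμ.derivOp ⟨z.1.state, state_mem hA hμ z.2⟩ +
    hμ.kernelMul (EnergySpace.mk hA z.1.veloc (veloc_mem hA hμ z.2)) := rfl
  rw [ExtendedStateSpace.inner_eq, e1, e2, e3, inner_neg_left, h1, inner_add_left, inner_add_left,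
    hμ.inner_kernelMul, real_inner_comm z.1.displ, real_inner_comm (hμ.integralMap z.1.state),
    real_inner_comm z.1.state]
  ring

/-- `c + A` is onto for `c ≥ 0`, with solutions in the energy space. -/
theorem exists_smul_add_apply_eq {c : ℝ} (hc : 0 ≤ c) (y : H) :
    ∃ (w : EnergySpace hA) (hw : EnergySpace.incl hA w ∈ A.domain),
      c • EnergySpace.incl hA w + A ⟨EnergySpace.incl hA w, hw⟩ = y := by
  obtain ⟨K, -, -, hAK⟩ := hA.compactInverse
  have hp : ∀ x, 0 ≤ ⟪K x, x⟫_ℝ := by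
    intro x
    obtain ⟨hx, hx'⟩ := hAK x
    by_cases h : (⟨K x, hx⟩ : A.domain) = 0
    · have : K x = 0 := congrArg Subtype.val h
      simp [this]
    · have := hA.pos _ h
      rw [hx', real_inner_comm] at this
      exact this.le
  -- The substitution `w = K x` turns the equation into `(c K + 1) x = y`, and `c K + 1` is coercive
  -- because `K` is positive.
  have hu : IsUnit (c • K + 1) := by
    refine ContinuousLinearMap.isUnit_of_forall_le_norm_inner_map _ (c := 1) one_pos fun x => ?_
    have e : ⟪(c • K + 1) x, x⟫_ℝ = c * ⟪K x, x⟫_ℝ + ‖x‖ ^ 2 := by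
      rw [← real_inner_self_eq_norm_sq, ← real_inner_smul_left, ← inner_add_left]
      rfl
    rw [e, NNReal.coe_one, mul_one]
    refine le_trans ?_ (le_abs_self _)
    linarith [mul_nonneg hc (hp x)]
  obtain ⟨x, hx⟩ := (ContinuousLinearMap.isUnit_iff_bijective.1 hu).2 y
  obtain ⟨h, h'⟩ := hAK x
  obtain ⟨hd, -, -⟩ := ((sqrtOp_spec hA).sq (K x) _).1 ⟨h, h'⟩
  refine ⟨EnergySpace.mk hA (K x) hd, h, ?_⟩
  rw [← hx]
  exact congrArg (fun t => c • K x + t) h'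

/-- The first equation gives `u = c⁻¹ (y₁ + v)`. By linearity the third gives `∫ ξ = κ v + C`, with
`C` coming from `y₃`. So `w = u + ∫ ξ` equals `θ v + (c⁻¹ y₁ + C)` with `θ = c⁻¹ + κ > 0`. Replacing
`v` by `w` in the second equation leaves `(c / θ) w + A w = y₂ + (c / θ) (c⁻¹ y₁ + C)`. -/
theorem generatorOp_surjective {c : ℝ} (hc : 0 < c) (y : ExtendedStateSpace hA ℓ μ) :
    ∃ z : (generatorOp hA hμ).domain,
      c • (z : ExtendedStateSpace hA ℓ μ) - generatorOp hA hμ z = y := by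
  obtain ⟨κ, hκ, hker⟩ := hμ.exists_smul_sub_derivOp_eq_kernelMul (X := EnergySpace hA) hc
  obtain ⟨ζ, hζ, -⟩ := hμ.exists_smul_sub_derivOp_eq hc y.state
  set C : EnergySpace hA := hμ.integralMap (ζ : StateSpace ℓ μ (EnergySpace hA))
  set θ : ℝ := c⁻¹ + κ
  have hθ : 0 < θ := by positivity
  obtain ⟨w, hw, hwe⟩ := exists_smul_add_apply_eq hA (c := c / θ) (by positivity)
    (y.veloc + (c / θ) • EnergySpace.incl hA (c⁻¹ • y.displ + C))
  set v : EnergySpace hA := θ⁻¹ • (w - (c⁻¹ • y.displ + C)) with hv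
  obtain ⟨ξ, hξ, hξi⟩ := hker v
  set u : EnergySpace hA := c⁻¹ • (y.displ + v) with hu
  have hwv : w = θ • v + (c⁻¹ • y.displ + C) := by
    rw [hv, smul_inv_smul₀ hθ.ne', sub_add_cancel]
  set χ : (hμ.derivOp (X := EnergySpace hA)).domain := ξ + ζ with hχ
  have hint : u + hμ.integralMap χ.1 = w := by
    rw [hχ, Submodule.coe_add, map_add, hξi, hwv, hu]
    change _ + (_ + C) = _
    simp only [θ]
    module
  have hdom : EnergySpace.incl hA (u + hμ.integralMap χ.1) ∈ A.domain := by
    rw [hint]; exact hw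
  have hmem : (triple u (EnergySpace.incl hA v) χ.1 : ExtendedStateSpace hA ℓ μ) ∈
      generatorDomain hA hμ := ⟨(v : (sqrtOp hA).domain).2, hdom, χ.2⟩
  refine ⟨⟨_, hmem⟩, ?_⟩
  have e1 : c • u - v = y.displ := by
    rw [hu, smul_inv_smul₀ hc.ne', add_sub_cancel_right]
  have e2 : c • EnergySpace.incl hA v -
      -A ⟨EnergySpace.incl hA (u + hμ.integralMap χ.1), hdom⟩ = y.veloc := by
    have h1 : A ⟨EnergySpace.incl hA (u + hμ.integralMap χ.1), hdom⟩ =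
        A ⟨EnergySpace.incl hA w, hw⟩ := by
      congr 1
      exact Subtype.ext (congrArg (EnergySpace.incl hA) hint)
    have h2 : c • EnergySpace.incl hA v = (c / θ) • EnergySpace.incl hA w -
        (c / θ) • EnergySpace.incl hA (c⁻¹ • y.displ + C) := by
      rw [← smul_sub, ← map_sub, hv, map_smul, smul_smul, div_eq_mul_inv]
    rw [h1, h2, sub_neg_eq_add, sub_add_eq_add_sub, hwe, add_sub_cancel_right]
  have e3 : c • χ.1 - (hμ.derivOp χ + hμ.kernelMul v) = y.state := by
    rw [hχ, LinearPMap.map_add, hξ, hζ, Submodule.coe_add]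
    module
  change (triple (c • u - v) (c • EnergySpace.incl hA v -
      -A ⟨EnergySpace.incl hA (u + hμ.integralMap χ.1), hdom⟩)
      (c • χ.1 - (hμ.derivOp χ + hμ.kernelMul v)) : ExtendedStateSpace hA ℓ μ) = y
  rw [e1, e2, e3]
  rfl

/-- The energy identity for the operator of the evolution equation. -/
theorem generatorOp_energy_identity (hℓ : 0 < ℓ) {ν₀ : ℝ}
    (hν : Tendsto (nu μ) (𝓝[>] 0) (𝓝 ν₀)) (z : (generatorOp hA hμ).domain) :
    ∃ f : ℝ → EnergySpace hA, IsContRep ℓ f z.1.state ∧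
      ∃ x₀ : EnergySpace hA, Tendsto f (𝓝[>] 0) (𝓝 x₀) ∧
        IntegrableOn (fun τ => deriv (nu μ) τ * ‖f τ‖ ^ 2) (memInterval ℓ) ∧
        2 * ⟪generatorOp hA hμ z, (z : ExtendedStateSpace hA ℓ μ)⟫_ℝ =
          -(ν₀ * ‖x₀‖ ^ 2) - ∫ τ in memInterval ℓ, deriv (nu μ) τ * ‖f τ‖ ^ 2 := by
  rw [inner_generatorOp]
  exact hμ.energy_identity hℓ hν (hμ.derivOp_spec ⟨z.1.state, state_mem hA hμ z.2⟩)
    (state_mem hA hμ z.2).2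

theorem isMaximalDissipative_generatorOp (hℓ : 0 < ℓ) :
    IsMaximalDissipative (generatorOp hA hμ) where
  dissipative z := by
    obtain ⟨ν₀, hν₀, hν⟩ := hμ.exists_tendsto_nu hℓ
    obtain ⟨f, -, x₀, -, -, h⟩ := generatorOp_energy_identity hA hμ hℓ hν z
    have h1 : 0 ≤ ∫ τ in memInterval ℓ, deriv (nu μ) τ * ‖f τ‖ ^ 2 :=
      setIntegral_nonneg (measurableSet_memInterval ℓ) fun τ hτ =>
        mul_nonneg (hμ.deriv_nu_nonneg hτ) (sq_nonneg _)
    have h2 : 0 ≤ ν₀ * ‖x₀‖ ^ 2 := by positivity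
    linarith
  surjective _ hc y := generatorOp_surjective hA hμ hc y

end Generator

end StateMemory

/-! ### The main theorem. -/

theorem theorem8p1 {H : Type*} [NormedAddCommGroup H] [InnerProductSpace ℝ H] [CompleteSpace H]
    [TopologicalSpace.SeparableSpace H]
    (A : H →ₗ.[ℝ] H) (hA : StateMemory.IsStrictlyPositiveOp A)
    (ℓ : EReal) (hℓ : 0 < ℓ) (μ : ℝ → ℝ) (hμ : StateMemory.IsMemoryKernel ℓ μ) :
    ∃ S : ℝ≥0 → StateMemory.ExtendedStateSpace hA ℓ μ →L[ℝ] StateMemory.ExtendedStateSpace hA ℓ μ,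
      -- the operator generates a contraction semigroup, and exactly one
      StateMemory.IsContractionSemigroup S ∧
      StateMemory.HasGenerator S (StateMemory.generatorOp hA hμ) ∧
      (∀ S' : ℝ≥0 →
          StateMemory.ExtendedStateSpace hA ℓ μ →L[ℝ] StateMemory.ExtendedStateSpace hA ℓ μ,
        StateMemory.IsContractionSemigroup S' →
        StateMemory.HasGenerator S' (StateMemory.generatorOp hA hμ) → S' = S) ∧
      -- `t ↦ S(t) z` is the unique mild solution with initial datum `z`
      (∀ z : StateMemory.ExtendedStateSpace hA ℓ μ,
        StateMemory.IsMildSolution (StateMemory.generatorOp hA hμ) z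
          (fun t : ℝ => S t.toNNReal z) ∧
        ∀ Z : ℝ → StateMemory.ExtendedStateSpace hA ℓ μ,
          StateMemory.IsMildSolution (StateMemory.generatorOp hA hμ) z Z →
            ∀ t : ℝ, 0 ≤ t → Z t = S t.toNNReal z) ∧
      -- the energy equality; `ν₀` is `ν(0)`, `f` is `ξᵗ`, `b` is `ν(0) ‖ξᵗ(0)‖²`
      ∃ ν₀ : ℝ, Tendsto (StateMemory.nu μ) (𝓝[>] 0) (𝓝 ν₀) ∧
        ∀ z ∈ (StateMemory.generatorOp hA hμ).domain, ∀ t : ℝ≥0,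
          S t z ∈ (StateMemory.generatorOp hA hμ).domain ∧
          ∃ f : ℝ → StateMemory.EnergySpace hA, StateMemory.IsContRep ℓ f (S t z).state ∧
            ∃ b : ℝ, Tendsto (fun τ => StateMemory.nu μ τ * ‖f τ‖ ^ 2) (𝓝[>] 0) (𝓝 b) ∧
              (ν₀ = 0 → b = 0) ∧
              (0 < ν₀ → ∃ x₀ : StateMemory.EnergySpace hA,
                Tendsto f (𝓝[>] 0) (𝓝 x₀) ∧ b = ν₀ * ‖x₀‖ ^ 2) ∧
              IntegrableOn (fun τ => deriv (StateMemory.nu μ) τ * ‖f τ‖ ^ 2)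
                (StateMemory.memInterval ℓ) ∧
              HasDerivWithinAt (fun r : ℝ => ‖S r.toNNReal z‖ ^ 2)
                (-b - ∫ τ in StateMemory.memInterval ℓ, deriv (StateMemory.nu μ) τ * ‖f τ‖ ^ 2)
                (Ici 0) (t : ℝ) := by
  have hT := StateMemory.isMaximalDissipative_generatorOp hA hμ hℓ
  have hS := hT.isContractionSemigroup
  obtain ⟨ν₀, -, hν⟩ := hμ.exists_tendsto_nu hℓ
  refine ⟨hT.semigroup, hS, hT.hasGenerator,
    fun S' hS' hg' => hS.eq_of_hasGenerator hT.dissipative hT.hasGenerator hS' hg',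
    fun z => ⟨hS.isMildSolution hT.hasGenerator z, fun Z hZ t ht =>
      hZ.eq_of_dissipative hT.dissipative (hS.isMildSolution hT.hasGenerator z) ht⟩,
    ν₀, hν, fun z hz t => ?_⟩
  obtain ⟨hmem, -⟩ := hS.map_generator hT.hasGenerator ⟨z, hz⟩ t
  obtain ⟨f, hf, x₀, hx₀, hi, he⟩ :=
    StateMemory.generatorOp_energy_identity hA hμ hℓ hν ⟨_, hmem⟩
  -- The trace `x₀` exists whatever `ν₀` is, so one value of `b` serves both cases.
  refine ⟨hmem, f, hf, ν₀ * ‖x₀‖ ^ 2, hν.mul (hx₀.norm.pow 2), fun h => by rw [h, zero_mul],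
    fun _ => ⟨x₀, hx₀, rfl⟩, hi, ?_⟩
  rw [← he]
  exact hT.hasDerivWithinAt_norm_sq ⟨z, hz⟩ t hmem
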